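/- An algebra over a finite functional signature $\tau$ is called $\omega$-categorical if all countably infinite models of its first-order theory are isomorphic. For such a structure $\mathfrak A$, $\mathrm{CSP}(\mathfrak A,\neq)$ is the computational problem of deciding whether a given finite conjunction of formulas of the form $s=t$ and $s\neq t$, where $s$ and $t$ are $\tau$-terms over a countably infinite set of variables, is satisfiable in $\mathfrak A$. An abelian group is regarded as an algebra over the signature $\{0,-,+\}$. **Proposition.** Let $\mathfrak G$ be an $\omega$-categorical abelian group. Then $\mathrm{CSP}(\mathfrak G,\neq)$ is in NP. -/

import Mathlib

/-! ### ω-categorical structures -/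

/-- `M` is ω-categorical: any two countably infinite models of the first-order theory of `M` are
isomorphic. (`M` may have any cardinality; in particular, finite structures qualify.) -/
def IsOmegaCategorical (L : FirstOrder.Language.{0, 0}) (M : Type*) [L.Structure M] : Prop :=
  Cardinal.Categorical Cardinal.aleph0.{0} (L.completeTheory M)

/-! ### The class NP -/

/-- `A`, a set of words over `Γ`, is in NP: there are a finite alphabet `Δ`, a predicate `V` on pairs
of words that a Turing machine (in the sense of Mathlib's `FinTM2`, whose input alphabet is finite)
computes in polynomial time, and a polynomial `p`, such that a word `x` is in `A` iff `V` accepts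
`x` together with some certificate of length at most `p |x|`. -/
def InNP {Γ : Type} (A : Set (List Γ)) : Prop :=
  ∃ (Δ : Type) (_ : Fintype Δ) (V : List Γ × List Δ → Bool) (p : Polynomial ℕ),
    Nonempty (Turing.TM2ComputableInPolyTime
      (Computability.encodingProd (Computability.encodingList Γ)
        (Computability.encodingList Δ)).encode
      Computability.encodeBool V) ∧
    ∀ x : List Γ, x ∈ A ↔ ∃ w : List Δ, w.length ≤ p.eval x.length ∧ V (x, w) = true

/-! ### The constraint satisfaction problem of an algebra expanded by `≠` -/

/-- An atomic formula `lhs = rhs` (if `isEq` is true) or `lhs ≠ rhs` (if `isEq` is false).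
The variables are named by binary words. -/
structure Constraint (L : FirstOrder.Language.{0, 0}) where
  lhs : L.Term (List Bool)
  isEq : Bool
  rhs : L.Term (List Bool)

/-- Whether the assignment `v` satisfies the constraint `c` in `M`. -/
def Constraint.Holds {L : FirstOrder.Language.{0, 0}} {M : Type*} [L.Structure M] (c : Constraint L)
    (v : List Bool → M) : Prop :=
  if c.isEq then c.lhs.realize v = c.rhs.realize v else c.lhs.realize v ≠ c.rhs.realize v

/-- The alphabet in which instances are written down. It is finite if `L` has finitely many
function symbols. -/
inductive CSPSymbol (L : FirstOrder.Language.{0, 0}) : Type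
  | func (f : Σ n, L.Functions n)
  | bit (b : Bool)
  | varEnd
  | rel (isEq : Bool)
  | sep

/-- A function symbol is written as itself, a variable as its name followed by an end marker. -/
def encodeToken {L : FirstOrder.Language.{0, 0}} : List Bool ⊕ (Σ n, L.Functions n) → List (CSPSymbol L)
  | .inl x => x.map .bit ++ [.varEnd]
  | .inr f => [.func f]

/-- A term is written in prefix notation. -/
def encodeTerm {L : FirstOrder.Language.{0, 0}} (t : L.Term (List Bool)) : List (CSPSymbol L) :=
  t.listEncode.flatMap encodeToken

def encodeConstraint {L : FirstOrder.Language.{0, 0}} (c : Constraint L) : List (CSPSymbol L) :=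
  encodeTerm c.lhs ++ .rel c.isEq :: (encodeTerm c.rhs ++ [.sep])

/-- An instance is a finite conjunction of constraints, written one after the other. -/
def encodeInstance {L : FirstOrder.Language.{0, 0}} (I : List (Constraint L)) : List (CSPSymbol L) :=
  I.flatMap encodeConstraint

/-- `CSP(M, ≠)` for an algebra `M` (a structure with purely functional signature `L`): the set of
(the words that encode) finite conjunctions of formulas `s = t` and `s ≠ t`, with `s` and `t`
terms over `L`, that are satisfiable in `M`. -/
def CSPNeq (L : FirstOrder.Language.{0, 0}) [L.IsAlgebraic] (M : Type*) [L.Structure M] :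
    Set (List (CSPSymbol L)) :=
  {x | ∃ I : List (Constraint L), encodeInstance I = x ∧
    ∃ v : List Bool → M, ∀ c ∈ I, c.Holds v}

/-! The encoding of instances is injective. -/

theorem encodeToken_append_inj {L : FirstOrder.Language.{0, 0}} {s t : List Bool ⊕ (Σ n, L.Functions n)}
    {a b : List (CSPSymbol L)} (h : encodeToken s ++ a = encodeToken t ++ b) : s = t ∧ a = b := by
  rcases s with x | f <;> rcases t with y | g
  · simp only [encodeToken, List.append_assoc, List.singleton_append, Sum.inl.injEq] at h ⊢
    induction x generalizing y with
    | nil => cases y <;> simp_all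
    | cons i x ih =>
      cases y with
      | nil => simp at h
      | cons j y =>
        simp only [List.map_cons, List.cons_append, List.cons.injEq, CSPSymbol.bit.injEq] at h
        obtain ⟨h1, h2⟩ := ih y h.2
        simp [h.1, h1, h2]
  · cases x <;> simp [encodeToken] at h
  · cases y <;> simp [encodeToken] at h
  · simpa [encodeToken] using h

theorem encodeTokens_append_inj {L : FirstOrder.Language.{0, 0}}
    {s t : List (List Bool ⊕ (Σ n, L.Functions n))} {a b : List (CSPSymbol L)} {p q : CSPSymbol L}
    (hp : (∃ i, p = .rel i) ∨ p = .sep) (hq : (∃ i, q = .rel i) ∨ q = .sep)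
    (h : s.flatMap encodeToken ++ p :: a = t.flatMap encodeToken ++ q :: b) :
    s = t ∧ p = q ∧ a = b := by
  have key : ∀ (r : CSPSymbol L) (u : List Bool ⊕ (Σ n, L.Functions n)) (c d : List (CSPSymbol L)),
      ((∃ i, r = .rel i) ∨ r = .sep) → r :: c ≠ encodeToken u ++ d := by
    rintro r (x | f) c d (⟨i, rfl⟩ | rfl) <;> [cases x; cases x; skip; skip] <;> simp [encodeToken]
  induction s generalizing t with
  | nil =>
    cases t with
    | nil => simpa using h
    | cons u t =>
      rw [List.flatMap_nil, List.nil_append, List.flatMap_cons, List.append_assoc] at h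
      exact absurd h (key _ _ _ _ hp)
  | cons u s ih =>
    cases t with
    | nil =>
      rw [List.flatMap_nil, List.nil_append, List.flatMap_cons, List.append_assoc] at h
      exact absurd h.symm (key _ _ _ _ hq)
    | cons w t =>
      simp only [List.flatMap_cons, List.append_assoc] at h
      obtain ⟨h1, h2⟩ := encodeToken_append_inj h
      obtain ⟨h3, h4⟩ := ih h2
      exact ⟨by rw [h1, h3], h4⟩

theorem encodeInstance_injective (L : FirstOrder.Language.{0, 0}) :
    Function.Injective (encodeInstance (L := L)) := by
  intro I
  induction I with
  | nil =>
    intro J h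
    cases J with
    | nil => rfl
    | cons d J => simp [encodeInstance, encodeConstraint] at h
  | cons c I ih =>
    intro J h
    cases J with
    | nil => simp [encodeInstance, encodeConstraint] at h
    | cons d J =>
      simp only [encodeInstance, List.flatMap_cons, encodeConstraint, List.append_assoc,
        List.cons_append, encodeTerm, List.nil_append] at h
      obtain ⟨h1, h2, h3⟩ := encodeTokens_append_inj (.inl ⟨_, rfl⟩) (.inl ⟨_, rfl⟩) h
      obtain ⟨h4, -, h5⟩ := encodeTokens_append_inj (.inr rfl) (.inr rfl) h3
      have h6 : c = d := by
        cases c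
        cases d
        simp only [CSPSymbol.rel.injEq] at h2
        simp only [Constraint.mk.injEq]
        exact ⟨FirstOrder.Language.Term.listEncode_injective h1, h2, FirstOrder.Language.Term.listEncode_injective h4⟩
      rw [h6, ih h5]

/-! ### Groups as algebras, in additive notation -/

/-- The function symbols of the signature `{0, -, +}` of groups. -/
inductive AddGroupFunc : ℕ → Type
  | zero : AddGroupFunc 0
  | neg : AddGroupFunc 1
  | add : AddGroupFunc 2

/-- The signature of groups. -/
def addGroupLang : FirstOrder.Language.{0, 0} where
  Functions := AddGroupFunc
  Relations := fun _ => Empty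

instance addGroupLangIsAlgebraic : addGroupLang.IsAlgebraic :=
  fun _ => inferInstanceAs (IsEmpty Empty)

/-- A group as an algebra. -/
instance addGroupStructure (G : Type*) [AddGroup G] : addGroupLang.Structure G where
  funMap {_} f := match f with
    | AddGroupFunc.zero => fun _ => 0
    | AddGroupFunc.neg => fun x => -x 0
    | AddGroupFunc.add => fun x => x 0 + x 1
  RelMap {_} r := r.elim

/-! If `G` is infinite, the Baire category form of the omitting types theorem shows that every type
of its theory in finitely many variables is isolated, so by compactness there are only finitely many
types of pairs. Comparing the types of the pairs `(g, k • g)` bounds the orders of all `g` at once.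
A finite `G` is killed by its order. So `G` has finite exponent.

Let `d` be the least positive number for which `D = d • G` is finite. A subgroup `N` maximal with `N
∩ D = 0` has finite index; put `H = G ⧸ N` and `K = ZMod d`. Elements of `D` are separated from `0`
by the map to `H`, and elements outside `D` by homomorphisms to `K`, since `G ⧸ D` has exponent
dividing `d`. Conversely `H`, a finite quotient of a torsion group, embeds in `G` by duality of
finite abelian groups. By Neumann's lemma on coverings by cosets and the minimality of `d`, every
finite subgroup of `G` is disjoint from some cyclic subgroup of order `d`. Hence `H × K ^ n` embeds
in `G` for every `n` (`AddCommGroup.exists_finite_separating`).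

Therefore an instance is satisfiable in `G` iff there are one assignment `f` to `H` and a nonempty
list of assignments `k` to `K` such that every `(f, k)` satisfies all equations and each inequation
is satisfied by some `(f, k)`. One `k` per constraint and one more suffice, so this data is a
certificate of polynomial size over a finite alphabet.

To check it, each certificate letter triggers one pass of a pushdown transducer over the instance:
passes spell the name of a variable, store a value at its occurrences, or evaluate all constraints.
The first evaluation freezes the components in `H`, which forces a common `f`. An evaluation also
parses the tape, so words that are not instances are rejected. A Turing machine simulates each pass
in linear time. -/

/-! ### Verifiers that make passes over a tape -/

/-- A verifier that keeps the input on a tape and, for every letter of the certificate, rewrites the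
tape in one pass of a pushdown transducer. -/
structure PassVerifier (Γ Δ Y Q P : Type) where
  /-- the tape symbol for an input letter -/
  ini : Γ → Y
  /-- the initial state -/
  init : Q
  /-- how a certificate letter changes the state before its pass -/
  start : Δ → Q → Q
  /-- the content of the pushdown store at the beginning of every pass -/
  base : P
  /-- from a state, a tape symbol and the popped pushdown symbol, the new state, the new tape symbol
  and up to two symbols to be pushed -/
  delta : Q → Y → Option P → Q × Y × Option P × Option P
  /-- whether a state is accepting -/
  accept : Q → Bool

namespace PassVerifier

variable {Γ Δ Y Q P : Type} (M : PassVerifier Γ Δ Y Q P)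

/-- The pushdown store after a step of the transducer. -/
def store (q : Q) (y : Y) (s : List P) : List P :=
  (M.delta q y s.head?).2.2.1.toList ++ ((M.delta q y s.head?).2.2.2.toList ++ s.tail)

/-- One run of the transducer. -/
def scan : Q → List P → List Y → Q × List Y
  | q, _, [] => (q, [])
  | q, s, y :: l =>
    let t := scan (M.delta q y s.head?).1 (M.store q y s) l
    (t.1, (M.delta q y s.head?).2.1 :: t.2)

/-- The pass for a letter of the certificate. -/
def pass (a : Q × List Y) (c : Δ) : Q × List Y :=
  M.scan (M.start c a.1) [M.base] a.2

/-- The verdict on an input and a certificate. -/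
def verdict (x : List Γ × List Δ) : Bool :=
  M.accept (x.2.foldl M.pass (M.init, x.1.map M.ini)).1

/-! ### Simulation of a pass verifier by a Turing machine with five stacks -/

/-- Names of the stacks of the Turing machine. -/
inductive Stack
  | input | fore | aft | store | output
  deriving DecidableEq

instance : Fintype Stack :=
  ⟨{Stack.input, .fore, .aft, .store, .output}, by rintro (_ | _) <;> simp⟩

/-- Labels of the Turing machine. -/
inductive Label
  | load | back | forth | finish
  deriving DecidableEq

instance : Fintype Label :=
  ⟨{Label.load, .back, .forth, .finish}, by rintro (_ | _) <;> simp⟩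

/-- The symbols on each stack. -/
def Alphabet (Γ Δ Y P : Type) : Stack → Type
  | .input => Γ ⊕ Δ
  | .fore => Y
  | .aft => Y
  | .store => P
  | .output => Bool

/-- The internal state of the Turing machine. -/
abbrev Reg (Γ Δ Y Q P : Type) : Type := Q × Option (Γ ⊕ Δ) × Option Y × Option P × Option P

open Turing.TM2.Stmt in
/-- The part of the program that writes the result of a step of the transducer. -/
def record [Inhabited P] [Inhabited Y] :
    Turing.TM2.Stmt (Alphabet Γ Δ Y P) Label (Reg Γ Δ Y Q P) :=
  -- The register is full here and after each `isSome` test, so `default` is never written. The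
  -- second store symbol is pushed first, so that the first one ends on top, as in `store`.
  push Stack.aft (fun v => v.2.2.1.getD default) <|
  branch (fun v => v.2.2.2.2.isSome)
    (push Stack.store (fun v => v.2.2.2.2.getD default) <|
      branch (fun v => v.2.2.2.1.isSome)
        (push Stack.store (fun v => v.2.2.2.1.getD default) <| goto fun _ => .forth)
        (goto fun _ => .forth))
    (branch (fun v => v.2.2.2.1.isSome)
      (push Stack.store (fun v => v.2.2.2.1.getD default) <| goto fun _ => .forth)
      (goto fun _ => .forth))

open Turing.TM2.Stmt in
/-- The program of the Turing machine. -/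
def program [Inhabited P] [Inhabited Y] :
    Label → Turing.TM2.Stmt (Alphabet Γ Δ Y P) Label (Reg Γ Δ Y Q P)
  | .load =>
    -- The pop that detects the end of the input word removes the first certificate letter, which
    -- therefore stays in the register until its pass begins.
    pop Stack.input (fun v a => (v.1, a, (a.bind Sum.getLeft?).map M.ini, none, none)) <|
    branch (fun v => v.2.2.1.isSome)
      (push Stack.aft (fun v => v.2.2.1.getD default) <| goto fun _ => .load)
      (goto fun _ => .back)
  | .back =>
    pop Stack.aft (fun v y => (v.1, v.2.1, y, none, none)) <|
    pop Stack.store (fun v s => (v.1, v.2.1, v.2.2.1, s, none)) <|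
    branch (fun v => v.2.2.1.isSome)
      (push Stack.fore (fun v => v.2.2.1.getD default) <| goto fun _ => .back) <|
    -- What the last pass left in the store is drained, so that the next pass starts with `M.base`
    -- alone.
    branch (fun v => v.2.2.2.1.isSome) (goto fun _ => .back) <|
    branch (fun v => (v.2.1.bind Sum.getRight?).isSome)
      (load (fun v => (((v.2.1.bind Sum.getRight?).map M.start).getD id v.1, none, none, none, none)) <|
        push Stack.store (fun _ => M.base) <| goto fun _ => .forth)
      (goto fun _ => .finish)
  | .forth =>
    pop Stack.fore (fun v y => (v.1, none, y, none, none)) <|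
    branch (fun v => v.2.2.1.isSome)
      (pop Stack.store (fun v s =>
          let r := M.delta v.1 (v.2.2.1.getD default) s
          (r.1, none, some r.2.1, r.2.2)) record)
      (pop Stack.input (fun v a => (v.1, a, none, none, none)) <| goto fun _ => .back)
  | .finish =>
    pop Stack.fore (fun v y => (v.1, none, y, none, none)) <|
    branch (fun v => v.2.2.1.isSome) (goto fun _ => .finish) <|
    push Stack.output (fun v => M.accept v.1) <|
    load (fun _ => (M.init, none, none, none, none)) halt

/-- The Turing machine. -/
def machine [Inhabited P] [Inhabited Y] [Fintype Γ] [Fintype Δ] [Fintype Y] [Fintype Q] [Fintype P] :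
    Turing.FinTM2 where
  K := Stack
  k₀ := .input
  k₁ := .output
  Γ := Alphabet Γ Δ Y P
  Λ := Label
  main := .load
  σ := Reg Γ Δ Y Q P
  initialState := (M.init, none, none, none, none)
  Γk₀Fin := inferInstanceAs (Fintype (Γ ⊕ Δ))
  m := M.program

/-- The contents of the stacks. -/
def contents (i : List (Γ ⊕ Δ)) (a b : List Y) (s : List P) (o : List Bool) :
    (k : Stack) → List (Alphabet Γ Δ Y P k)
  | .input => i
  | .fore => a
  | .aft => b
  | .store => s
  | .output => o

theorem length_store_le (q : Q) (y : Y) (s : List P) : (M.store q y s).length ≤ s.length + 2 := by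
  have : ∀ o : Option P, o.toList.length ≤ 1 := fun o => by cases o <;> simp
  have h₁ := this (M.delta q y s.head?).2.2.1
  have h₂ := this (M.delta q y s.head?).2.2.2
  simp only [store, List.length_append, List.length_tail]
  omega

theorem length_scan (q : Q) (s : List P) (l : List Y) : (M.scan q s l).2.length = l.length := by
  induction l generalizing q s with
  | nil => rfl
  | cons y l ih => simp [scan, ih]

/-! ### Step counts of the simulation -/

variable [Inhabited P] [Inhabited Y]

/-- The configuration with the given label, internal state and stacks. -/
def cfg (l : Option Label) (v : Reg Γ Δ Y Q P) (i : List (Γ ⊕ Δ)) (a b : List Y) (s : List P)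
    (o : List Bool) : Turing.TM2.Cfg (Alphabet Γ Δ Y P) Label (Reg Γ Δ Y Q P) :=
  ⟨l, v, contents i a b s o⟩

/-- `c'` is reached from `c` in at most `n` steps. -/
def ReachesIn (n : ℕ) (c c' : Turing.TM2.Cfg (Alphabet Γ Δ Y P) Label (Reg Γ Δ Y Q P)) : Prop :=
  ∃ k ≤ n, (flip bind (Turing.TM2.step M.program))^[k] (some c) = some c'

variable {M}

theorem ReachesIn.trans {m n : ℕ} {c₁ c₂ c₃ : Turing.TM2.Cfg (Alphabet Γ Δ Y P) Label (Reg Γ Δ Y Q P)}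
    (h₁ : M.ReachesIn m c₁ c₂) (h₂ : M.ReachesIn n c₂ c₃) : M.ReachesIn (m + n) c₁ c₃ := by
  obtain ⟨k, hk, h₁⟩ := h₁
  obtain ⟨l, hl, h₂⟩ := h₂
  exact ⟨l + k, by omega, by rw [Function.iterate_add_apply, h₁, h₂]⟩

theorem ReachesIn.mono {m n : ℕ} {c c' : Turing.TM2.Cfg (Alphabet Γ Δ Y P) Label (Reg Γ Δ Y Q P)}
    (h : M.ReachesIn m c c') (hmn : m ≤ n) : M.ReachesIn n c c' := by
  obtain ⟨k, hk, h⟩ := h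
  exact ⟨k, hk.trans hmn, h⟩

theorem ReachesIn.single {c c' : Turing.TM2.Cfg (Alphabet Γ Δ Y P) Label (Reg Γ Δ Y Q P)}
    (h : Turing.TM2.step M.program c = some c') : M.ReachesIn 1 c c' :=
  ⟨1, le_rfl, h⟩

variable (M)

-- Stacks are compared one name at a time: at a concrete name the updates reduce to `contents` by
-- computation, whereas as functions of the name they do not.
omit [Inhabited P] [Inhabited Y] in
theorem cfg_ext {c c' : Turing.TM2.Cfg (Alphabet Γ Δ Y P) Label (Reg Γ Δ Y Q P)} (hl : c.l = c'.l)
    (hv : c.var = c'.var) (hs : ∀ k, c.stk k = c'.stk k) : some c = some c' := by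
  cases c
  cases c'
  cases hl
  cases hv
  cases funext hs
  rfl

theorem step_load_inl (v : Reg Γ Δ Y Q P) (g : Γ) (i : List (Γ ⊕ Δ)) (b : List Y) :
    ∃ v' : Reg Γ Δ Y Q P, v'.1 = v.1 ∧ M.ReachesIn 1 (cfg (some .load) v (.inl g :: i) [] b [] [])
      (cfg (some .load) v' i [] (M.ini g :: b) [] []) :=
  ⟨(v.1, some (.inl g), some (M.ini g), none, none), rfl, .single (cfg_ext rfl rfl (by rintro (_ | _) <;> rfl))⟩

theorem step_load_last (v : Reg Γ Δ Y Q P) (w : List Δ) (b : List Y) :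
    M.ReachesIn 1 (cfg (some .load) v (w.map .inr) [] b [] [])
      (cfg (some .back) (v.1, w.head?.map .inr, none, none, none) (w.tail.map .inr) [] b [] []) :=
  .single (by cases w <;> exact cfg_ext rfl rfl (by rintro (_ | _) <;> rfl))

theorem step_back_some (q : Q) (c : Option (Γ ⊕ Δ)) (u : Option Y × Option P × Option P) (i : List (Γ ⊕ Δ)) (a b : List Y) (y : Y)
    (s : List P) :
    ∃ u', M.ReachesIn 1 (cfg (some .back) (q, c, u) i a (y :: b) s [])
      (cfg (some .back) (q, c, u') i (y :: a) b s.tail []) :=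
  ⟨(some y, s.head?, none), .single (cfg_ext rfl rfl (by rintro (_ | _) <;> rfl))⟩

theorem step_back_none (q : Q) (c : Option (Γ ⊕ Δ)) (u : Option Y × Option P × Option P) (i : List (Γ ⊕ Δ)) (a : List Y) (p : P)
    (s : List P) :
    ∃ u', M.ReachesIn 1 (cfg (some .back) (q, c, u) i a [] (p :: s) [])
      (cfg (some .back) (q, c, u') i a [] s []) :=
  ⟨(none, some p, none), .single (cfg_ext rfl rfl (by rintro (_ | _) <;> rfl))⟩

theorem step_back_start (q : Q) (c : Δ) (u : Option Y × Option P × Option P) (i : List (Γ ⊕ Δ)) (a : List Y) :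
    M.ReachesIn 1 (cfg (some .back) (q, some (.inr c), u) i a [] [] [])
      (cfg (some .forth) (M.start c q, none, none, none, none) i a [] [M.base] []) :=
  .single (cfg_ext rfl rfl (by rintro (_ | _) <;> rfl))

theorem step_back_finish (q : Q) (u : Option Y × Option P × Option P) (i : List (Γ ⊕ Δ)) (a : List Y) :
    M.ReachesIn 1 (cfg (some .back) (q, none, u) i a [] [] [])
      (cfg (some .finish) (q, none, none, none, none) i a [] [] []) :=
  .single (cfg_ext rfl rfl (by rintro (_ | _) <;> rfl))

theorem step_forth_some (q : Q) (u : Option Y × Option P × Option P) (i : List (Γ ⊕ Δ)) (y : Y) (a b : List Y)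
    (s : List P) :
    ∃ u', M.ReachesIn 1 (cfg (some .forth) (q, none, u) i (y :: a) b s [])
      (cfg (some .forth) ((M.delta q y s.head?).1, none, u') i a ((M.delta q y s.head?).2.1 :: b)
        (M.store q y s) []) := by
  refine ⟨(some (M.delta q y s.head?).2.1, (M.delta q y s.head?).2.2), .single ?_⟩
  -- The result of `delta` is generalized so that cases on the two optional pushes decide the
  -- branches of `record`.
  have key : ∀ r : Q × Y × Option P × Option P,
      some (Turing.TM2.stepAux record (r.1, none, some r.2.1, r.2.2)
        (Function.update (Function.update (contents (Γ := Γ) (Δ := Δ) i (y :: a) b s [])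
          Stack.fore a) Stack.store s.tail)) =
        some (cfg (some .forth) (r.1, none, some r.2.1, r.2.2) i a (r.2.1 :: b)
          (r.2.2.1.toList ++ (r.2.2.2.toList ++ s.tail)) []) := by
    rintro ⟨q', y', _ | s₁, _ | s₂⟩ <;> exact cfg_ext rfl rfl (by rintro (_ | _) <;> rfl)
  exact key _

theorem step_forth_none (q : Q) (u : Option Y × Option P × Option P) (w : List Δ) (b : List Y)
    (s : List P) :
    M.ReachesIn 1 (cfg (some .forth) (q, none, u) (w.map .inr) [] b s [])
      (cfg (some .back) (q, w.head?.map .inr, none, none, none) (w.tail.map .inr) [] b s []) :=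
  .single (by cases w <;> exact cfg_ext rfl rfl (by rintro (_ | _) <;> rfl))

theorem step_finish_some (q : Q) (u : Option Y × Option P × Option P) (y : Y) (a : List Y) :
    ∃ u', M.ReachesIn 1 (cfg (some .finish) (q, none, u) [] (y :: a) [] [] [])
      (cfg (some .finish) (q, none, u') [] a [] [] []) :=
  ⟨(some y, none, none), .single (cfg_ext rfl rfl (by rintro (_ | _) <;> rfl))⟩

theorem step_finish_none (q : Q) (u : Option Y × Option P × Option P) :
    M.ReachesIn 1 (cfg (some .finish) (q, none, u) [] [] [] [] [])
      (cfg none (M.init, none, none, none, none) [] [] [] [] [M.accept q]) :=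
  .single (cfg_ext rfl rfl (by rintro (_ | _) <;> rfl))

theorem reachesIn_load (x : List Γ) (w : List Δ) (b : List Y) (v : Reg Γ Δ Y Q P) :
    M.ReachesIn (x.length + 1) (cfg (some .load) v (x.map .inl ++ w.map .inr) [] b [] [])
      (cfg (some .back) (v.1, w.head?.map .inr, none, none, none) (w.tail.map .inr) []
        ((x.map M.ini).reverse ++ b) [] []) := by
  induction x generalizing b v with
  | nil => simpa using M.step_load_last v w b
  | cons g x ih =>
    obtain ⟨v', hv, h⟩ := M.step_load_inl v g (x.map .inl ++ w.map .inr) b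
    have := h.trans (ih (M.ini g :: b) v')
    rw [hv] at this
    simpa [Nat.add_comm 1] using this

theorem reachesIn_back (q : Q) (c : Option (Γ ⊕ Δ)) (i : List (Γ ⊕ Δ)) (a b : List Y) (s : List P)
    (u : Option Y × Option P × Option P) :
    ∃ u', M.ReachesIn (b.length + s.length) (cfg (some .back) (q, c, u) i a b s [])
      (cfg (some .back) (q, c, u') i (b.reverse ++ a) [] [] []) := by
  induction b generalizing a s u with
  | nil =>
    induction s generalizing u with
    | nil => exact ⟨u, 0, le_rfl, rfl⟩
    | cons p s ih =>
      obtain ⟨u₁, h₁⟩ := M.step_back_none q c u i a p s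
      obtain ⟨u₂, h₂⟩ := ih u₁
      exact ⟨u₂, (h₁.trans h₂).mono (by simp; omega)⟩
  | cons y b ih =>
    obtain ⟨u₁, h₁⟩ := M.step_back_some q c u i a b y s
    obtain ⟨u₂, h₂⟩ := ih (y :: a) s.tail u₁
    exact ⟨u₂, by simpa using (h₁.trans h₂).mono (by simp; omega)⟩

/-- The store grows by at most two per tape symbol. This bound on what is left over makes the
draining in the next backward sweep linear. -/
theorem reachesIn_forth (w : List Δ) (a b : List Y) (s : List P) (q : Q)
    (u : Option Y × Option P × Option P) :
    ∃ s' : List P, s'.length ≤ s.length + 2 * a.length ∧ M.ReachesIn (a.length + 1)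
      (cfg (some .forth) (q, none, u) (w.map .inr) a b s [])
      (cfg (some .back) ((M.scan q s a).1, w.head?.map .inr, none, none, none) (w.tail.map .inr) []
        ((M.scan q s a).2.reverse ++ b) s' []) := by
  induction a generalizing b s q u with
  | nil => exact ⟨s, by simp, by simpa [scan] using M.step_forth_none q u w b s⟩
  | cons y a ih =>
    obtain ⟨u₁, h₁⟩ := M.step_forth_some q u (w.map .inr) y a b s
    obtain ⟨s', hs, h₂⟩ := ih ((M.delta q y s.head?).2.1 :: b) (M.store q y s)
      (M.delta q y s.head?).1 u₁
    refine ⟨s', ?_, ?_⟩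
    · have := M.length_store_le q y s
      simp only [List.length_cons]
      omega
    · simpa [scan] using (h₁.trans h₂).mono (by omega)

theorem reachesIn_finish (q : Q) (u : Option Y × Option P × Option P) (a : List Y) :
    M.ReachesIn (a.length + 1) (cfg (some .finish) (q, none, u) [] a [] [] [])
      (cfg none (M.init, none, none, none, none) [] [] [] [] [M.accept q]) := by
  induction a generalizing u with
  | nil => exact M.step_finish_none q u
  | cons y a ih =>
    obtain ⟨u₁, h₁⟩ := M.step_finish_some q u y a
    exact (h₁.trans (ih u₁)).mono (by simp; omega)

/-- A letter costs at most `3n + 1` steps backward (tape and leftover store), one to start, and `n +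
1` forward. Emptying the tape at the end costs as much as a forward sweep, whence the extra factor
`w.length + 1`. -/
theorem reachesIn_passes (n : ℕ) (w : List Δ) (q : Q) (l : List Y) (s : List P) (hl : l.length = n)
    (hs : s.length ≤ 2 * n + 1) (u : Option Y × Option P × Option P) :
    M.ReachesIn ((w.length + 1) * (4 * n + 4))
      (cfg (some .back) (q, w.head?.map .inr, u) (w.tail.map .inr) [] l.reverse s [])
      (cfg none (M.init, none, none, none, none) [] [] [] []
        [M.accept (w.foldl M.pass (q, l)).1]) := by
  induction w generalizing q l s u with
  | nil =>
    obtain ⟨u₁, h₁⟩ := M.reachesIn_back q none [] [] l.reverse s u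
    have h₂ := (h₁.trans (M.step_back_finish q u₁ _ _)).trans (M.reachesIn_finish q _ _)
    refine ReachesIn.mono h₂ ?_
    simp
    omega
  | cons c w ih =>
    obtain ⟨u₁, h₁⟩ := M.reachesIn_back q (some (.inr c)) (w.map .inr) [] l.reverse s u
    obtain ⟨s', hs', h₂⟩ := M.reachesIn_forth w l [] [M.base] (M.start c q) (none, none, none)
    have h₃ := ih (M.scan (M.start c q) [M.base] l).1 (M.scan (M.start c q) [M.base] l).2 s'
      (by rw [length_scan, hl]) (by simp at hs'; omega) (none, none, none)
    have h₄ := M.step_back_start q c u₁ (w.map .inr) l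
    simp only [List.reverse_reverse, List.append_nil] at h₁ h₂
    refine ReachesIn.mono (((h₁.trans h₄).trans h₂).trans h₃) ?_
    simp only [List.length_reverse, List.length_cons]
    have : (w.length + 1 + 1) * (4 * n + 4) = (w.length + 1) * (4 * n + 4) + (4 * n + 4) := by ring
    omega

/-- The verdict of a pass verifier is computed by a Turing machine in polynomial time. -/
theorem computableInPolyTime [Fintype Γ] [Fintype Δ] [Fintype Y] [Fintype Q] [Fintype P] :
    Nonempty (Turing.TM2ComputableInPolyTime
      (Computability.encodingProd (Computability.encodingList Γ)
        (Computability.encodingList Δ)).encode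
      Computability.encodeBool M.verdict) := by
  refine ⟨{
    tm := M.machine
    inputAlphabet := Equiv.refl _
    outputAlphabet := Equiv.refl _
    -- Loading plus passes, with the lengths of the word and of the certificate both bounded by
    -- their sum.
    time := (Polynomial.X + 1) + (Polynomial.X + 1) * (4 * Polynomial.X + 4)
    outputsFun := fun x => Classical.choice ?_ }⟩
  obtain ⟨x, w⟩ := x
  have h₁ := M.reachesIn_load x w [] (M.init, none, none, none, none)
  rw [List.append_nil] at h₁
  have h := h₁.trans
    (M.reachesIn_passes x.length w M.init (x.map M.ini) [] (by simp) (by simp) (none, none, none))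
  obtain ⟨k, hk, h⟩ := h
  refine ⟨⟨⟨k, ?_⟩, hk.trans ?_⟩⟩
  · refine Eq.trans (congrArg _ (congrArg some ?_)) (h.trans (congrArg some ?_))
    · simp only [Turing.initList, cfg, machine]
      congr 1
      funext k
      cases k <;> simp [contents, Computability.encodingProd, Computability.encodingList]
      all_goals first | rfl | exact List.map_id _
    · simp only [Turing.haltList, cfg, machine]
      congr 1
      funext k
      cases k <;> simp [contents, Computability.encodeBool, verdict]
      all_goals rfl
  · simp [Computability.encodingProd, Computability.encodingList]
    gcongr <;> omega

end PassVerifier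

/-! ### Abelian groups of finite exponent -/

/-- The range meets `S` in a finite subgroup, whose index in the range is the index of the preimage
of `S`. -/
theorem AddMonoidHom.finite_range_of_finiteIndex_comap {A B : Type*} [AddGroup A] [AddGroup B]
    (f : A →+ B) (S : AddSubgroup B) [Finite S] [(S.comap f).FiniteIndex] : Finite f.range := by
  have h : (S.addSubgroupOf f.range).FiniteIndex :=
    ⟨by rw [← AddSubgroup.relIndex, ← AddSubgroup.index_comap]; exact AddSubgroup.FiniteIndex.index_ne_zero⟩
  have : Finite (S.addSubgroupOf f.range) :=
    Finite.of_injective (fun x => (⟨x.1.1, x.2⟩ : S)) fun x y h =>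
      Subtype.ext (Subtype.ext (Subtype.mk.inj h))
  have : Nat.card f.range ≠ 0 := by
    rw [← AddSubgroup.card_mul_index (S.addSubgroupOf f.range)]
    exact mul_ne_zero Nat.card_pos.ne' h.index_ne_zero
  exact (Nat.card_ne_zero.1 this).2

/-- The `p * a`-torsion is the preimage of the `a`-torsion under multiplication by `p`, and each
nonempty fibre of that map is a coset of the `p`-torsion. -/
theorem AddCommGroup.finite_setOf_nsmul_eq_zero {A : Type*} [AddCommGroup A]
    (h : ∀ p : ℕ, p.Prime → {x : A | p • x = 0}.Finite) {n : ℕ} (hn : n ≠ 0) :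
    {x : A | n • x = 0}.Finite := by
  induction n using induction_on_primes with
  | zero => exact absurd rfl hn
  | one => simp
  | prime_mul p a hp ih =>
    have ha : a ≠ 0 := right_ne_zero_of_mul hn
    refine ((ih ha).preimage' (f := fun x : A => p • x) fun b _ => ?_).subset fun x hx => ?_
    · rcases Set.eq_empty_or_nonempty ((fun x : A => p • x) ⁻¹' {b}) with he | ⟨y, hy⟩
      · rw [he]
        exact Set.finite_empty
      · refine ((h p hp).image (y + ·)).subset fun x hx => ⟨x - y, ?_, by simp⟩
        simp only [Set.mem_preimage, Set.mem_singleton_iff] at hx hy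
        simp [smul_sub, hx, hy]
    · simpa [mul_smul, smul_comm a p] using hx

/-- A quotient of a finite abelian group is isomorphic to a subgroup. -/
theorem AddCommGroup.exists_injective_of_surjective {A B : Type*} [AddCommGroup A] [AddCommGroup B]
    [Finite A] (f : A →+ B) (hf : Function.Surjective f) :
    ∃ j : B →+ A, Function.Injective j := by
  have : Finite B := Finite.of_surjective f hf
  -- A finite abelian group is isomorphic to its group of complex characters, and dualizing the
  -- surjection gives an injection of character groups.
  obtain ⟨eA⟩ := CommGroup.monoidHom_mulEquiv_of_hasEnoughRootsOfUnity (Multiplicative A) ℂ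
  obtain ⟨eB⟩ := CommGroup.monoidHom_mulEquiv_of_hasEnoughRootsOfUnity (Multiplicative B) ℂ
  let c : (Multiplicative B →* ℂˣ) →* (Multiplicative A →* ℂˣ) :=
    MonoidHom.compHom' (AddMonoidHom.toMultiplicative f)
  have hc : Function.Injective c := fun x y h => by
    refine MonoidHom.ext fun b => ?_
    obtain ⟨a, ha⟩ := hf b.toAdd
    have := DFunLike.congr_fun h (Multiplicative.ofAdd a)
    have h2 : AddMonoidHom.toMultiplicative f (Multiplicative.ofAdd a) = b :=
      congrArg Multiplicative.ofAdd ha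
    simpa only [c, MonoidHom.compHom'_apply_apply, MonoidHom.comp_apply, h2] using this
  refine ⟨MonoidHom.toAdditive (eA.toMonoidHom.comp (c.comp eB.symm.toMonoidHom)), ?_⟩
  exact eA.injective.comp (hc.comp eB.symm.injective)

/-- A finite quotient of a torsion abelian group is isomorphic to a subgroup. -/
theorem AddCommGroup.exists_injective_of_surjective_of_torsion {A B : Type*} [AddCommGroup A]
    [AddCommGroup B] [Finite B] (hA : IsAddTorsion A) (f : A →+ B)
    (hf : Function.Surjective f) : ∃ j : B →+ A, Function.Injective j := by
  -- Finitely many preimages generate a finite subgroup that already maps onto `B`, which reduces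
  -- the claim to finite groups.
  choose s hs using hf
  let F : AddSubgroup A := AddSubgroup.closure (Set.range s)
  have : AddGroup.FG F := (AddGroup.fg_iff_addSubgroup_fg F).2
    ⟨(Set.finite_range s).toFinset, by simp [F]⟩
  have : Finite F := AddCommGroup.finite_of_fg_isAddTorsion _ (hA.addSubgroup F)
  obtain ⟨j, hj⟩ := AddCommGroup.exists_injective_of_surjective (f.comp F.subtype)
    (fun b => ⟨⟨s b, AddSubgroup.subset_closure ⟨b, rfl⟩⟩, hs b⟩)
  exact ⟨F.subtype.comp j, Subtype.val_injective.comp hj⟩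

/-- Homomorphisms to `ZMod d` separate the points of an abelian group of exponent `d`. -/
theorem AddCommGroup.exists_hom_zmod_ne_zero {A : Type*} [AddCommGroup A] {d : ℕ} (hd : d ≠ 0)
    (hA : ∀ x : A, d • x = 0) {a : A} (ha : a ≠ 0) : ∃ χ : A →+ ZMod d, χ a ≠ 0 := by
  -- A character to `ℚ / ℤ` that does not vanish at `a` takes values killed by `d`; these lie in the
  -- subgroup generated by `1 / d`, a copy of `ZMod d`.
  obtain ⟨c, hc⟩ := CharacterModule.exists_character_apply_ne_zero_of_ne_zero ha
  change A →+ AddCircle (1 : ℚ) at c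
  have : Fact ((0 : ℚ) < 1) := ⟨one_pos⟩
  have hd' : (d : ℚ) ≠ 0 := Nat.cast_ne_zero.2 hd
  let u : AddCircle (1 : ℚ) := ((1 / d : ℚ) : AddCircle (1 : ℚ))
  have hu : addOrderOf u = d := by
    have := AddCircle.addOrderOf_period_div (p := (1 : ℚ)) (n := d) (Nat.pos_of_ne_zero hd)
    exact this
  let e : ZMod d →+ AddCircle (1 : ℚ) := ZMod.lift d ⟨zmultiplesHom _ u, by
    simp [← hu, addOrderOf_nsmul_eq_zero]⟩
  have he : Function.Injective e := by
    refine (ZMod.lift_injective _).2 fun m hm => ?_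
    rw [ZMod.intCast_zmod_eq_zero_iff_dvd, ← hu, addOrderOf_dvd_iff_zsmul_eq_zero]
    simpa using hm
  have hr : ∀ x, c x ∈ e.range := fun x => by
    have : d • c x = 0 := by rw [← map_nsmul, hA, map_zero]
    obtain ⟨k, -, hk⟩ := (AddCircle.nsmul_eq_zero_iff (Nat.pos_of_ne_zero hd)).1 this
    refine ⟨(k : ℤ), ?_⟩
    simp only [e, ZMod.lift_coe, u]
    rw [← hk, zmultiplesHom_apply, natCast_zsmul, ← AddCircle.coe_nsmul, nsmul_eq_mul, mul_one_div,
      mul_one]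
  let E := AddMonoidHom.ofInjective he
  refine ⟨E.symm.toAddMonoidHom.comp (c.codRestrict e.range hr), fun h => hc ?_⟩
  have h2 : c.codRestrict e.range hr a = 0 := by
    have := congrArg E h
    simpa using this
  exact congrArg Subtype.val h2

section exponent

variable {G : Type*} [AddCommGroup G]

/-- If `d` is the least number such that `d • G` is finite, then every finite subgroup is disjoint
from a cyclic subgroup of order `d`. -/
theorem AddCommGroup.exists_disjoint_zmultiples {d : ℕ} (hd : d ≠ 0)
    [Finite (nsmulAddMonoidHom (α := G) d).range]
    (hmin : ∀ k, k ≠ 0 → k < d → ¬ Finite (nsmulAddMonoidHom (α := G) k).range)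
    (S : AddSubgroup G) [Finite S] :
    ∃ g : G, d • g = 0 ∧ ∀ k : ℤ, k • g ∈ S → (d : ℤ) ∣ k := by
  let T := (nsmulAddMonoidHom (α := G) d).ker
  have hT : T.FiniteIndex := AddSubgroup.finiteIndex_ker _
  let f : ℕ → T →+ G := fun p => (nsmulAddMonoidHom (d / p)).comp T.subtype
  -- Otherwise the preimages of `S` under the maps `f p` cover the `d`-torsion `T`, and by Neumann's
  -- lemma one of them has finite index. Then `(d / p) • T` is finite, and so is `(d / p) • G`,
  -- because `T` has finite index in `G`. This contradicts the minimality of `d`.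
  obtain ⟨g, hg⟩ : ∃ g : T, ∀ p ∈ d.primeFactors, f p g ∉ S := by
    by_contra! hcon
    obtain ⟨p, hp, hfin⟩ := AddSubgroup.exists_finiteIndex_of_leftCoset_cover
      (s := d.primeFactors) (H := fun p => S.comap (f p)) (g := fun _ => 0) (by
        rw [Set.eq_univ_iff_forall]
        intro g
        obtain ⟨p, hp, h⟩ := hcon g
        simp only [Set.mem_iUnion]
        exact ⟨p, hp, ⟨g, h, zero_add g⟩⟩)
    have hpp := Nat.prime_of_mem_primeFactors hp
    have h1 : Finite (f p).range := (f p).finite_range_of_finiteIndex_comap S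
    have h2 : ((f p).range.comap (nsmulAddMonoidHom (d / p))).FiniteIndex :=
      AddSubgroup.finiteIndex_of_le (H := T) fun x hx => ⟨⟨x, hx⟩, rfl⟩
    exact hmin (d / p)
      (Nat.div_pos (Nat.le_of_dvd (Nat.pos_of_ne_zero hd) (Nat.dvd_of_mem_primeFactors hp)) hpp.pos).ne'
      (Nat.div_lt_self (Nat.pos_of_ne_zero hd) hpp.one_lt)
      ((nsmulAddMonoidHom (d / p)).finite_range_of_finiteIndex_comap (f p).range)
  refine ⟨g, g.2, fun k hk => ?_⟩
  by_contra hdk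
  -- By Bézout `e • g ∈ S`. As `e` is a proper divisor of `d`, it divides `d / p` for some prime `p
  -- ∣ d`, which contradicts the choice of `g`.
  let e := Int.gcd k d
  have he : ((e : ℕ) : ℤ) • (g : G) ∈ S := by
    have hdg : (d : ℤ) • (g : G) = 0 := by
      rw [natCast_zsmul]
      exact g.2
    rw [show ((e : ℕ) : ℤ) = _ from Int.gcd_eq_gcd_ab k d, add_smul, mul_comm k, mul_comm (d : ℤ), mul_smul,
      mul_smul, hdg, smul_zero, add_zero]
    exact S.zsmul_mem hk _
  have hed : e ∣ d := Int.natCast_dvd_natCast.1 (Int.gcd_dvd_right k d)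
  obtain ⟨t, ht⟩ := hed
  have ht1 : t ≠ 1 := by
    rintro rfl
    rw [mul_one] at ht
    exact hdk (by rw [ht]; exact Int.gcd_dvd_left k d)
  obtain ⟨p, hp, r, rfl⟩ := Nat.exists_prime_and_dvd ht1
  refine hg p (Nat.mem_primeFactors.2 ⟨hp, ⟨e * r, by rw [ht]; ring⟩, hd⟩) ?_
  have : d / p = r * e := Nat.div_eq_of_eq_mul_right hp.pos (by rw [ht]; ring)
  change (d / p) • (g : G) ∈ S
  rw [this, mul_smul, ← natCast_zsmul _ e]
  exact S.nsmul_mem he r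

/-- `ZMod d` is sent onto a cyclic subgroup disjoint from the image of `A`, so that the sum of the
two maps is direct. -/
theorem AddCommGroup.exists_injective_prod_zmod {d : ℕ} (hd : d ≠ 0)
    [Finite (nsmulAddMonoidHom (α := G) d).range]
    (hmin : ∀ k, k ≠ 0 → k < d → ¬ Finite (nsmulAddMonoidHom (α := G) k).range)
    {A : Type*} [AddCommGroup A] [Finite A] (j : A →+ G) (hj : Function.Injective j) :
    ∃ i : A × ZMod d →+ G, Function.Injective i := by
  have : Finite j.range := Set.finite_range j
  obtain ⟨g, hdg, hg⟩ := AddCommGroup.exists_disjoint_zmultiples hd hmin j.range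
  let e : ZMod d →+ G := ZMod.lift d ⟨zmultiplesHom _ g, by simpa using hdg⟩
  refine ⟨j.coprod e, (injective_iff_map_eq_zero _).2 ?_⟩
  rintro ⟨a, z⟩ h
  obtain ⟨k, rfl⟩ := ZMod.intCast_surjective z
  simp only [AddMonoidHom.coprod_apply] at h
  have hk : k • g = j (-a) := by
    rw [map_neg, ← add_eq_zero_iff_eq_neg', ← h]
    simp [e]
  have hz : ((k : ℤ) : ZMod d) = 0 := (ZMod.intCast_zmod_eq_zero_iff_dvd _ _).2 (hg k ⟨_, hk.symm⟩)
  rw [hz, map_zero, add_zero] at h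
  rw [(injective_iff_map_eq_zero j).1 hj a h, hz]
  rfl

/-- For a finite subgroup `D` of an abelian group of finite exponent there is a finite quotient in
which `D` embeds. -/
theorem AddCommGroup.exists_finite_quotient {m : ℕ} (hm : m ≠ 0) (hG : ∀ g : G, m • g = 0)
    (D : AddSubgroup G) [Finite D] :
    ∃ N : AddSubgroup G, Finite (G ⧸ N) ∧ ∀ x ∈ D, x ∈ N → x = 0 := by
  -- `N` is maximal among the subgroups that meet `D` trivially.
  obtain ⟨N, hN⟩ := zorn_le₀ {N : AddSubgroup G | ∀ x ∈ D, x ∈ N → x = 0} (by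
    intro c hc hchain
    rcases c.eq_empty_or_nonempty with rfl | hne
    · exact ⟨⊥, by simp, by simp⟩
    · refine ⟨sSup c, fun x hxD hx => ?_, fun N hN => le_sSup hN⟩
      obtain ⟨N, hN, hxN⟩ := (AddSubgroup.mem_sSup_of_directedOn hne hchain.directedOn).1 hx
      exact hc hN x hxD hxN)
  refine ⟨N, ?_, hN.prop⟩
  have hfin : {x : G ⧸ N | m • x = 0}.Finite := by
    refine AddCommGroup.finite_setOf_nsmul_eq_zero (fun p hp => ?_) hm
    -- The `p`-torsion of `G ⧸ N` lies in the image of `D`: if `p • g ∈ N` and `g ∉ N`, then by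
    -- maximality some `n + k • g` with `n ∈ N` is a nonzero element of `D`. Here `p ∤ k`, as
    -- otherwise this element would be in `N`. So modulo `N` a multiple of it equals `g`.
    refine ((Set.toFinite (D : Set G)).image (QuotientAddGroup.mk' N)).subset fun x hx => ?_
    obtain ⟨g, rfl⟩ := QuotientAddGroup.mk'_surjective N x
    change _ ∈ D.map (QuotientAddGroup.mk' N)
    by_cases hg : g ∈ N
    · exact ⟨0, D.zero_mem, by simpa using ((QuotientAddGroup.eq_zero_iff g).2 hg).symm⟩
    have hlt : ¬ N ⊔ AddSubgroup.zmultiples g ≤ N := fun h =>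
      hg (h (AddSubgroup.mem_sup_right (AddSubgroup.mem_zmultiples g)))
    have hnot := fun h => hlt (hN.le_of_ge (y := N ⊔ AddSubgroup.zmultiples g) h le_sup_left)
    change ¬ (∀ x ∈ D, x ∈ N ⊔ AddSubgroup.zmultiples g → x = 0) at hnot
    push Not at hnot
    obtain ⟨y, hyD, hy, hy0⟩ := hnot
    obtain ⟨n, hn, z, hz, rfl⟩ := AddSubgroup.mem_sup.1 hy
    obtain ⟨k, rfl⟩ := AddSubgroup.mem_zmultiples_iff.1 hz
    have hpk : ¬ (p : ℤ) ∣ k := by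
      rintro ⟨l, rfl⟩
      refine hy0 (hN.prop _ hyD (N.add_mem hn ?_))
      rw [mul_comm, mul_smul, natCast_zsmul]
      refine N.zsmul_mem ?_ l
      rw [← QuotientAddGroup.eq_zero_iff]
      exact hx
    have hco : IsCoprime k (p : ℤ) :=
      ((Nat.prime_iff_prime_int.1 hp).coprime_iff_not_dvd.2 hpk).symm
    obtain ⟨a, b, hab⟩ := hco
    refine (D.map (QuotientAddGroup.mk' N)).zsmul_mem ⟨_, hyD, rfl⟩ a |> fun h => ?_
    convert h using 1
    have h1 : (QuotientAddGroup.mk' N) n = 0 := (QuotientAddGroup.eq_zero_iff n).2 hn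
    have h2 : (p : ℤ) • (QuotientAddGroup.mk' N g) = 0 := by rw [natCast_zsmul]; exact hx
    rw [map_add, h1, zero_add, map_zsmul, smul_smul]
    calc (QuotientAddGroup.mk' N) g = (a * k + b * p) • (QuotientAddGroup.mk' N) g := by
          rw [hab, one_smul]
      _ = _ := by rw [add_smul, mul_smul b, h2, smul_zero, add_zero]
  have huniv : {x : G ⧸ N | m • x = 0} = Set.univ := by
    rw [Set.eq_univ_iff_forall]
    intro x
    obtain ⟨g, rfl⟩ := QuotientAddGroup.mk'_surjective N x
    rw [Set.mem_ofPred_eq, ← map_nsmul, hG, map_zero]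
  exact Set.finite_univ_iff.1 (huniv ▸ hfin)

/-- An abelian group `G` of finite exponent is described by two finite groups `H` and `K`: the points
of `G` are separated by one homomorphism to `H` and the homomorphisms to `K`, and products of `H`
with finitely many copies of `K` embed in `G`. -/
theorem AddCommGroup.exists_finite_separating {m : ℕ} (hm : m ≠ 0) (hG : ∀ g : G, m • g = 0) :
    ∃ (H K : Type) (_ : AddCommGroup H) (_ : AddCommGroup K) (_ : Finite H) (_ : Finite K),
      (∃ π : G →+ H, ∀ g ≠ 0, π g ≠ 0 ∨ ∃ χ : G →+ K, χ g ≠ 0) ∧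
      (∃ j : H →+ G, Function.Injective j) ∧
      ∀ (A : Type) [AddCommGroup A] [Finite A], (∃ j : A →+ G, Function.Injective j) →
        ∃ j : A × K →+ G, Function.Injective j := by
  classical
  have hex : ∃ d, d ≠ 0 ∧ Finite (nsmulAddMonoidHom (α := G) d).range := by
    refine ⟨m, hm, ?_⟩
    have : Set.range (nsmulAddMonoidHom (α := G) m) ⊆ {0} := by
      rintro _ ⟨g, rfl⟩
      exact hG g
    exact (Set.finite_singleton 0).subset this
  let d := Nat.find hex
  obtain ⟨hd, hfin⟩ : d ≠ 0 ∧ Finite (nsmulAddMonoidHom (α := G) d).range := Nat.find_spec hex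
  have hmin : ∀ k, k ≠ 0 → k < d → ¬ Finite (nsmulAddMonoidHom (α := G) k).range :=
    fun k hk hkd h => Nat.find_min hex hkd ⟨hk, h⟩
  let D := (nsmulAddMonoidHom (α := G) d).range
  obtain ⟨N, hNfin, hN⟩ := AddCommGroup.exists_finite_quotient hm hG D
  have : NeZero d := ⟨hd⟩
  -- `G` may live in any universe, but the values in certificates must form a type in `Type`.
  let e : Shrink.{0} (G ⧸ N) ≃+ G ⧸ N := Shrink.addEquiv
  refine ⟨Shrink.{0} (G ⧸ N), ZMod d, inferInstance, inferInstance, Finite.of_equiv _ e.symm.toEquiv,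
    inferInstance, ⟨e.symm.toAddMonoidHom.comp (QuotientAddGroup.mk' N), fun g hg => ?_⟩, ?_,
    fun A _ _ ⟨j, hj⟩ => AddCommGroup.exists_injective_prod_zmod hd hmin j hj⟩
  · by_cases hgD : g ∈ D
    · refine .inl fun h => hg (hN g hgD ((QuotientAddGroup.eq_zero_iff g).1 ?_))
      exact e.symm.injective (by simpa using h)
    · obtain ⟨χ, hχ⟩ := AddCommGroup.exists_hom_zmod_ne_zero (A := G ⧸ D) hd (fun x => by
        obtain ⟨y, rfl⟩ := QuotientAddGroup.mk'_surjective D x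
        rw [← map_nsmul]
        exact (QuotientAddGroup.eq_zero_iff _).2 ⟨y, rfl⟩)
        (a := (g : G ⧸ D)) (by rwa [ne_eq, QuotientAddGroup.eq_zero_iff])
      exact .inr ⟨χ.comp (QuotientAddGroup.mk' D), hχ⟩
  · obtain ⟨j, hj⟩ := AddCommGroup.exists_injective_of_surjective_of_torsion
      (fun g => isOfFinAddOrder_iff_nsmul_eq_zero.2 ⟨m, Nat.pos_of_ne_zero hm, hG g⟩)
      (QuotientAddGroup.mk' N) (QuotientAddGroup.mk'_surjective N)
    exact ⟨j.comp e.toAddMonoidHom, hj.comp e.injective⟩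

end exponent

/-! ### Satisfiability in abelian groups of finite exponent -/

theorem realize_comp_addMonoidHom {A B : Type*} [AddGroup A] [AddGroup B] (φ : A →+ B) {α : Type*}
    (v : α → A) (t : addGroupLang.Term α) : t.realize (φ ∘ v) = φ (t.realize v) := by
  induction t with
  | var _ => rfl
  | func f ts ih =>
    cases f with
    | zero => exact (map_zero φ).symm
    | neg => exact (congrArg (-·) (ih 0)).trans (map_neg φ _).symm
    | add => exact (congrArg₂ (· + ·) (ih 0) (ih 1)).trans (map_add φ _ _).symm

theorem realize_prod_eq_iff {A B : Type*} [AddGroup A] [AddGroup B] {α : Type*} (f : α → A) (k : α → B)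
    (s t : addGroupLang.Term α) :
    s.realize (fun x => (f x, k x)) = t.realize (fun x => (f x, k x)) ↔
      s.realize f = t.realize f ∧ s.realize k = t.realize k := by
  have h1 : ∀ r : addGroupLang.Term α, (r.realize fun x => (f x, k x)).1 = r.realize f := fun r =>
    (realize_comp_addMonoidHom (AddMonoidHom.fst A B) (fun x => (f x, k x)) r).symm
  have h2 : ∀ r : addGroupLang.Term α, (r.realize fun x => (f x, k x)).2 = r.realize k := fun r =>
    (realize_comp_addMonoidHom (AddMonoidHom.snd A B) (fun x => (f x, k x)) r).symm
  rw [Prod.ext_iff, h1, h1, h2, h2]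

theorem realize_comp_eq_iff {A B : Type*} [AddGroup A] [AddGroup B] {φ : A →+ B}
    (hφ : Function.Injective φ) {α : Type*} (v : α → A) (s t : addGroupLang.Term α) :
    s.realize (φ ∘ v) = t.realize (φ ∘ v) ↔ s.realize v = t.realize v := by
  rw [realize_comp_addMonoidHom, realize_comp_addMonoidHom, hφ.eq_iff]

/-- Finitely many assignments to groups `H` and `K` are combined into one to a group that contains
products of `H` with copies of `K`. -/
theorem exists_assignment_realize_eq_iff {G : Type*} [AddCommGroup G] {H K : Type} [AddCommGroup H]
    [AddCommGroup K] [Finite H] [Finite K] (hH : ∃ j : H →+ G, Function.Injective j)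
    (hK : ∀ (A : Type) [AddCommGroup A] [Finite A], (∃ j : A →+ G, Function.Injective j) →
      ∃ j : A × K →+ G, Function.Injective j) {α : Type*} (f : α → H) (ks : List (α → K)) :
    ∃ v : α → G, ∀ s t : addGroupLang.Term α, s.realize v = t.realize v ↔
      s.realize f = t.realize f ∧ ∀ k ∈ ks, s.realize k = t.realize k := by
  suffices h : ∃ (A : Type) (_ : AddCommGroup A) (_ : Finite A) (a : α → A),
      (∃ j : A →+ G, Function.Injective j) ∧ ∀ s t : addGroupLang.Term α,
        s.realize a = t.realize a ↔
          s.realize f = t.realize f ∧ ∀ k ∈ ks, s.realize k = t.realize k by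
    obtain ⟨A, _, _, a, ⟨j, hj⟩, h⟩ := h
    exact ⟨j ∘ a, fun s t => by rw [realize_comp_eq_iff hj, h]⟩
  induction ks with
  | nil => exact ⟨H, inferInstance, inferInstance, f, hH, by simp⟩
  | cons k ks ih =>
    obtain ⟨A, _, _, a, hj, h⟩ := ih
    refine ⟨A × K, inferInstance, inferInstance, fun x => (a x, k x), hK A hj, fun s t => ?_⟩
    rw [realize_prod_eq_iff, h, List.forall_mem_cons, and_assoc, and_comm (a := ∀ k ∈ ks, _)]

/-- A list of assignments to `H × K` with a common first component `f` and with second components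
`ks` witnesses an instance if all of them satisfy the equations of the instance, and each of its
inequations is satisfied by one of them. -/
def Witnesses {H K : Type} [AddCommGroup H] [AddCommGroup K] (I : List (Constraint addGroupLang))
    (f : List Bool → H) (ks : List (List Bool → K)) : Prop :=
  (∀ k ∈ ks, ∀ c ∈ I, c.isEq = true → c.Holds fun x => (f x, k x)) ∧
    ∀ c ∈ I, c.isEq = false → ∃ k ∈ ks, c.Holds fun x => (f x, k x)

/-- A solution in `G` is pushed forward along `π` and, for each constraint, along a homomorphism to
`K` chosen to keep an inequation true. Equations survive every homomorphism. -/
theorem exists_witnesses {G : Type*} [AddCommGroup G] {H K : Type} [AddCommGroup H]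
    [AddCommGroup K] (hsep : ∃ π : G →+ H, ∀ g ≠ 0, π g ≠ 0 ∨ ∃ χ : G →+ K, χ g ≠ 0)
    {I : List (Constraint addGroupLang)} {v : List Bool → G} (hv : ∀ c ∈ I, c.Holds v) :
    ∃ (f : List Bool → H) (ks : List (List Bool → K)), ks ≠ [] ∧ ks.length ≤ I.length + 1 ∧
      Witnesses I f ks := by
  obtain ⟨π, hπ⟩ := hsep
  have hχ : ∀ c : Constraint addGroupLang, ∃ χ : G →+ K, c.isEq = false → c.Holds v →
      c.Holds (π.prod χ ∘ v) := by
    intro c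
    by_cases hc : c.lhs.realize v = c.rhs.realize v
    · exact ⟨0, fun h h' => absurd hc (by simpa [Constraint.Holds, h] using h')⟩
    · rcases hπ _ (sub_ne_zero.2 hc) with h | ⟨χ, h⟩
      · refine ⟨0, fun he _ => ?_⟩
        simp only [Constraint.Holds, he, realize_comp_addMonoidHom]
        simp only [map_sub, sub_ne_zero] at h
        exact fun h' => h (congrArg Prod.fst h')
      · refine ⟨χ, fun he _ => ?_⟩
        simp only [Constraint.Holds, he, realize_comp_addMonoidHom]
        simp only [map_sub, sub_ne_zero] at h
        exact fun h' => h (congrArg Prod.snd h')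
  choose χ hχ using hχ
  -- The zero assignment keeps the list nonempty when `I` is empty.
  refine ⟨π ∘ v, ((0 : G →+ K) ∘ v) :: I.map fun c => χ c ∘ v, by simp, by simp, ?_, ?_⟩
  · have key : ∀ (ψ : G →+ K), ∀ c ∈ I, c.isEq = true → c.Holds (π.prod ψ ∘ v) := by
      intro ψ c hc he
      have := hv c hc
      simp only [Constraint.Holds, he, realize_comp_addMonoidHom] at this ⊢
      simp_all
    intro k hk
    rcases List.mem_cons.1 hk with rfl | hk
    · exact key 0
    · obtain ⟨c, -, rfl⟩ := List.mem_map.1 hk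
      exact key (χ c)
  · exact fun c hc he => ⟨_, List.mem_cons_of_mem _ (List.mem_map_of_mem hc), hχ c he (hv c hc)⟩

/-- In the combined assignment an equation holds iff it holds in every component, so one good
component makes an inequation true. The list must be nonempty because the equations are checked in
`H` only together with some `k`. -/
theorem Witnesses.satisfiable {G : Type*} [AddCommGroup G] {H K : Type} [AddCommGroup H]
    [AddCommGroup K] [Finite H] [Finite K] (hH : ∃ j : H →+ G, Function.Injective j)
    (hK : ∀ (A : Type) [AddCommGroup A] [Finite A], (∃ j : A →+ G, Function.Injective j) →
      ∃ j : A × K →+ G, Function.Injective j) {I : List (Constraint addGroupLang)}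
    {f : List Bool → H} {ks : List (List Bool → K)} (hw : Witnesses I f ks) (hne : ks ≠ []) :
    ∃ v : List Bool → G, ∀ c ∈ I, c.Holds v := by
  obtain ⟨heq, hneq⟩ := hw
  obtain ⟨v, hv⟩ := exists_assignment_realize_eq_iff hH hK f ks
  refine ⟨v, fun c hc => ?_⟩
  cases he : c.isEq
  · obtain ⟨k, hk, h⟩ := hneq c hc he
    simp only [Constraint.Holds, he, Bool.false_eq_true, if_false, ne_eq, realize_prod_eq_iff] at h ⊢
    rw [hv]
    exact fun h' => h ⟨h'.1, h'.2 k hk⟩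
  · have h := fun k hk => heq k hk c hc he
    simp only [Constraint.Holds, he, if_true, realize_prod_eq_iff] at h ⊢
    obtain ⟨k, hk⟩ := List.exists_mem_of_ne_nil ks hne
    exact (hv _ _).2 ⟨(h k hk).1, fun k hk => (h k hk).2⟩

/-! ### Omitting types -/

section OmittingTypes

open FirstOrder FirstOrder.Language FirstOrder.Language.Theory

variable {L : FirstOrder.Language.{0, 0}} {T : L.Theory}

/-- Basic open sets of types are given by formulas and every type is realized in a model, so density
can be checked on realizations. -/
theorem FirstOrder.Language.Theory.CompleteType.dense_of_forall_realize {α : Type}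
    {W : Set (T.CompleteType α)}
    (h : ∀ (M : ModelType.{0, 0, 0} T) (v : α → M) (ψ : L.Formula α), ψ.Realize v →
      ∃ (N : ModelType.{0, 0, 0} T) (w : α → N), ψ.Realize w ∧ T.typeOf w ∈ W) : Dense W := by
  rw [_root_.CompleteType.isTopologicalBasis_range_typesWith.dense_iff]
  rintro _ ⟨ψ, rfl⟩ ⟨q, hq⟩
  obtain ⟨M, v, rfl⟩ := exists_modelType_is_realized_in T q
  obtain ⟨N, w, hw, hW⟩ := h M v (Formula.equivSentence.symm ψ) (CompleteType.mem_typeOf.1 hq)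
  exact ⟨_, CompleteType.mem_typeOf.2 hw, hW⟩

theorem FirstOrder.Language.Theory.isOpen_setOf_formula_mem {α : Type} (φ : L.Formula α) :
    IsOpen {q : T.CompleteType α | Formula.equivSentence φ ∈ q} :=
  _root_.CompleteType.isOpen_typesWith _

theorem FirstOrder.Language.Formula.realize_congr {α M : Type*} [DecidableEq α] [L.Structure M]
    {φ : L.Formula α} {v w : α → M} (h : ∀ a ∈ φ.freeVarFinset, v a = w a) :
    φ.Realize v ↔ φ.Realize w :=
  (BoundedFormula.realize_restrictFreeVar (f := Subtype.val) v fun _ => rfl).symm.trans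
    (BoundedFormula.realize_restrictFreeVar (f := Subtype.val) w fun a => h a a.2)

/-- `φ` with existential quantifiers over all variables but those in the range of `i`. -/
theorem FirstOrder.Language.Formula.exists_project {β : Type} [Finite β] (i : β → ℕ) (φ : L.Formula ℕ) :
    ∃ χ : L.Formula β, ∀ (M : Type) [Nonempty M] [L.Structure M] (x : β → M),
      χ.Realize x ↔ ∃ w : ℕ → M, φ.Realize w ∧ w ∘ i = x := by
  classical
  have : Fintype β := Fintype.ofFinite β
  -- The quantified variables include the range of `i`; the formulas `e` identify them with the free
  -- variables `β`.
  let s : Finset ℕ := φ.freeVarFinset ∪ Finset.univ.image i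
  let ψ : L.Formula (β ⊕ s) := φ.restrictFreeVar fun y => .inr ⟨y, by simp [s, y.2]⟩
  let e : β → L.Formula (β ⊕ s) := fun b =>
    (Term.var (.inr ⟨i b, by simp [s]⟩)).equal (Term.var (.inl b))
  refine ⟨(ψ ⊓ Formula.iInf e).iExs s, fun M _ _ x => ?_⟩
  have hψ : ∀ (u : s → M) (w : ℕ → M), (∀ y : s, w y = u y) →
      (ψ.Realize (Sum.elim x u) ↔ φ.Realize w) := fun u w h =>
    BoundedFormula.realize_restrictFreeVar w fun y => (h _).symm
  have he : ∀ u : s → M, (Formula.iInf e).Realize (Sum.elim x u) ↔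
      ∀ b, u ⟨i b, by simp [s]⟩ = x b := fun u => by
    simp [e, Formula.realize_equal]
  rw [Formula.realize_iExs]
  constructor
  · rintro ⟨u, hu⟩
    rw [Formula.realize_inf, he] at hu
    let w : ℕ → M := fun n => if h : n ∈ s then u ⟨n, h⟩ else Classical.arbitrary M
    have hw : ∀ y : s, w y = u y := fun y => by simp [w]
    exact ⟨w, (hψ u w hw).1 hu.1, funext fun b => (hw ⟨i b, by simp [s]⟩).trans (hu.2 b)⟩
  · rintro ⟨w, hw, rfl⟩
    refine ⟨fun y => w y, ?_⟩
    rw [Formula.realize_inf, he]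
    exact ⟨(hψ _ w fun _ => rfl).2 hw, fun _ => rfl⟩

/-- The omitting types theorem for a single type in finitely many variables. -/
theorem FirstOrder.Language.Theory.exists_countable_model_omitting [Countable L.Symbols]
    (hT : T.IsSatisfiable) {β : Type} [Finite β] (p : T.CompleteType β) (hp : ¬ IsOpen {p}) :
    ∃ M : ModelType.{0, 0, 0} T, Countable M ∧ p ∉ T.realizedTypes M β := by
  have : Nonempty (T.CompleteType ℕ) := CompleteType.nonempty_iff.2 hT
  -- A realization `v` of a type in `U i` has a subtuple `v ∘ i` that omits `p`. A type in `W θ`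
  -- provides a witness for `θ` among the entries of `v`, if there is one at all.
  let U : (β → ℕ) → Set (T.CompleteType ℕ) := fun i =>
    ⋃ φ ∈ {φ : L.Formula β | Formula.equivSentence φ ∈ p},
      {q | Formula.equivSentence (φ.not.relabel i : L.Formula ℕ) ∈ q}
  let W : L.Formula (ℕ ⊕ Fin 1) → Set (T.CompleteType ℕ) := fun θ =>
    {q | Formula.equivSentence (θ.iExs (Fin 1)).not ∈ q} ∪
      ⋃ n : ℕ, {q | Formula.equivSentence (θ.relabel (Sum.elim id fun _ => n) : L.Formula ℕ) ∈ q}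
  have hUo : ∀ i, IsOpen (U i) := fun i =>
    isOpen_biUnion fun φ _ => isOpen_setOf_formula_mem _
  have hWo : ∀ θ, IsOpen (W θ) := fun θ =>
    (isOpen_setOf_formula_mem _).union (isOpen_iUnion fun n => isOpen_setOf_formula_mem _)
  have hUd : ∀ i, Dense (U i) := by
    intro i
    refine CompleteType.dense_of_forall_realize fun M v ψ hψ => ?_
    -- If every realization of `ψ` had type `p` along `i`, the projection `χ` of `ψ` would isolate
    -- `p`.
    obtain ⟨χ, hχ⟩ := ψ.exists_project i
    obtain ⟨N, w, hw, hne⟩ : ∃ (N : ModelType.{0, 0, 0} T) (w : ℕ → N), ψ.Realize w ∧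
        T.typeOf (w ∘ i) ≠ p := by
      by_contra! hcon
      refine hp ?_
      have : {p} = {q : T.CompleteType β | Formula.equivSentence χ ∈ q} := by
        ext q
        constructor
        · intro hq
          have hM : Formula.equivSentence χ ∈ T.typeOf (v ∘ i) :=
            (CompleteType.formula_mem_typeOf (T := T)).2 ((hχ M _).2 ⟨v, hψ, rfl⟩)
          rwa [hcon M v hψ, ← Set.mem_singleton_iff.1 hq] at hM
        · intro hq
          obtain ⟨N, x, rfl⟩ := exists_modelType_is_realized_in T q
          have hx : χ.Realize x := (CompleteType.formula_mem_typeOf (T := T)).1 hq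
          obtain ⟨w, hw, rfl⟩ := (hχ N x).1 hx
          exact hcon N w hw
      rw [this]
      exact isOpen_setOf_formula_mem χ
    refine ⟨N, w, hw, ?_⟩
    obtain ⟨φ, hφp, hφ⟩ : ∃ φ : L.Formula β, Formula.equivSentence φ ∈ p ∧ ¬ φ.Realize (w ∘ i) := by
      by_contra! hcon
      refine hne (SetLike.ext fun σ => ?_)
      have key : ∀ σ : L[[β]].Sentence, σ ∈ p → σ ∈ T.typeOf (w ∘ i) := fun σ hσ =>
        CompleteType.mem_typeOf.2 (hcon (Formula.equivSentence.symm σ) (by simpa using hσ))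
      refine ⟨fun h => ?_, key σ⟩
      by_contra hσ
      exact (CompleteType.not_mem_iff _ _).1 (key _ ((CompleteType.not_mem_iff p σ).2 hσ)) h
    refine Set.mem_biUnion hφp ?_
    refine (CompleteType.formula_mem_typeOf (T := T)).2 ?_
    rw [Formula.realize_relabel]
    exact hφ
  have hWd : ∀ θ, Dense (W θ) := by
    classical
    intro θ
    refine CompleteType.dense_of_forall_realize fun M v ψ hψ => ?_
    by_cases hθ : (θ.iExs (Fin 1)).Realize v
    · obtain ⟨y, hy⟩ := Formula.realize_iExs.1 hθ
      -- A variable that occurs in neither formula is free to be reassigned to the witness.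
      obtain ⟨n, hn⟩ := Infinite.exists_notMem_finset (ψ.freeVarFinset ∪ θ.freeVarFinset.toLeft)
      rw [Finset.mem_union, not_or] at hn
      have hv : ∀ a, a ≠ n → Function.update v n (y 0) a = v a := fun a ha =>
        Function.update_of_ne ha _ _
      refine ⟨M, Function.update v n (y 0), ?_, Set.mem_union_right _ (Set.mem_iUnion.2 ⟨n, ?_⟩)⟩
      · exact (Formula.realize_congr fun a ha => hv a fun h => hn.1 (h ▸ ha)).2 hψ
      · refine (CompleteType.formula_mem_typeOf (T := T)).2 ?_
        rw [Formula.realize_relabel]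
        refine (Formula.realize_congr ?_).2 hy
        rintro (a | a) ha
        · exact hv a fun h => hn.2 (h ▸ Finset.mem_toLeft.2 ha)
        · rw [Subsingleton.elim a 0]
          exact Function.update_self _ _ _
    · exact ⟨M, v, hψ, Set.mem_union_left _ ((CompleteType.formula_mem_typeOf (T := T)).2 hθ)⟩
  -- The Baire category theorem for the countably many sets `U i` and `W θ`.
  obtain ⟨q, hq⟩ := ((dense_iInter_of_isOpen (f := Sum.elim U W)
    (by rintro (i | θ) <;> [exact hUo i; exact hWo θ])
    (by rintro (i | θ) <;> [exact hUd i; exact hWd θ])).nonempty)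
  obtain ⟨M, v, rfl⟩ := exists_modelType_is_realized_in T q
  -- By the Tarski–Vaught test, the range of a realization of `q` is an elementary substructure.
  have hmeet : L.MeetsDefinable (Set.range v) := by
    rintro D ⟨a, ha⟩ hD
    obtain ⟨φ, hφ⟩ := Set.definable_iff_exists_formula_sum.1 hD
    choose r hr using fun x : Set.range v => x.2
    have hφ' : ∀ y : Fin 1 → M, φ.Realize (Sum.elim (↑) y) ↔ y 0 ∈ D := fun y => by
      have := Set.ext_iff.1 hφ y
      exact this.symm
    have hφr : ∀ y : Fin 1 → M, (φ.relabel (Sum.map r id) : L.Formula (ℕ ⊕ Fin 1)).Realize (Sum.elim v y) ↔ y 0 ∈ D :=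
      fun y => by
        rw [← hφ', Formula.realize_relabel, Sum.elim_comp_map]
        have : v ∘ r = (↑) := funext hr
        rw [this, Function.comp_id]
    rcases Set.mem_iInter.1 hq (.inr (φ.relabel (Sum.map r id))) with h | h
    · refine absurd ?_ ((CompleteType.formula_mem_typeOf (T := T)).1 h)
      exact Formula.realize_iExs.2 ⟨fun _ => a, (hφr _).2 ha⟩
    · obtain ⟨n, hn⟩ := Set.mem_iUnion.1 h
      have := (CompleteType.formula_mem_typeOf (T := T)).1 hn
      rw [Formula.realize_relabel, Sum.comp_elim] at this
      exact ⟨v n, (hφr _).1 this, n, rfl⟩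
  let S := hmeet.toElementarySubstructure
  have hS : (S : Set M) = Set.range v := hmeet.closure_eq_self
  have hSc : Countable S := by
    have : (S : Set M).Countable := hS ▸ Set.countable_range v
    exact this.to_subtype
  have : Nonempty S := ⟨⟨v 0, by rw [← SetLike.mem_coe, hS]; exact ⟨0, rfl⟩⟩⟩
  have hST : S ⊨ T := (S.theory_model_iff T).2 inferInstance
  refine ⟨ModelType.of T S, hSc, ?_⟩
  rintro ⟨(x : β → S), hx⟩
  have hxv : ∀ b, ∃ n, v n = x b := fun b => by
    have : (x b : M) ∈ (S : Set M) := (x b).2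
    rwa [hS] at this
  choose i hi using hxv
  obtain ⟨φ, hφp, hφ⟩ := Set.mem_iUnion₂.1 (Set.mem_iInter.1 hq (.inl i))
  have h1 : (φ.not.relabel i : L.Formula ℕ).Realize v :=
    (CompleteType.formula_mem_typeOf (T := T)).1 hφ
  rw [Formula.realize_relabel] at h1
  have h2 : φ.Realize (M := S) x := by
    rw [← hx] at hφp
    exact (CompleteType.formula_mem_typeOf (T := T)).1 hφp
  have h3 := (S.subtype.map_formula φ x).2 h2
  rw [show S.subtype ∘ x = v ∘ i from (funext hi).symm] at h3
  exact h1 h3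

end OmittingTypes

/-! ### Finitely many types in an ℵ₀-categorical theory -/

section Categorical

open FirstOrder FirstOrder.Language FirstOrder.Language.Theory

variable {L : FirstOrder.Language.{0, 0}} {T : L.Theory}

theorem FirstOrder.Language.Theory.typeOf_elementaryEmbedding_comp {M N β : Type*} [L.Structure M]
    [L.Structure N] [Nonempty M] [Nonempty N] [M ⊨ T] [N ⊨ T] (f : M ↪ₑ[L] N) (x : β → M) :
    T.typeOf (f ∘ x) = T.typeOf x := by
  refine SetLike.ext fun φ => ?_
  rw [CompleteType.mem_typeOf, CompleteType.mem_typeOf, f.map_formula]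

/-- All types of an `ℵ₀`-categorical theory in finitely many variables are isolated. -/
theorem Cardinal.Categorical.isOpen_singleton [Countable L.Symbols] (hT : T.IsSatisfiable)
    (hinf : ∀ M : ModelType.{0, 0, 0} T, Infinite M) (hcat : Cardinal.aleph0.{0}.Categorical T)
    {β : Type} [Finite β] (p : T.CompleteType β) : IsOpen {p} := by
  by_contra hp
  obtain ⟨M, hMc, hM⟩ := exists_countable_model_omitting hT p hp
  obtain ⟨N, v, hv⟩ := exists_modelType_is_realized_in T p
  have := hinf M
  have := hinf N
  have hL : L.card ≤ Cardinal.aleph0 := Cardinal.mk_le_aleph0_iff.2 inferInstance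
  -- By Löwenheim–Skolem some countable model realizes `p`; by categoricity it is isomorphic to `M`,
  -- which omits `p`.
  obtain ⟨S, hvS, hS⟩ := exists_elementarySubstructure_card_eq L (Set.range v) Cardinal.aleph0.{0}
    le_rfl (by simp) (by simpa using hL) (by simp)
  have : Infinite S := Cardinal.infinite_iff.2 (by simpa using hS.ge)
  have hST : S ⊨ T := (S.theory_model_iff T).2 inferInstance
  obtain ⟨e⟩ := hcat (ModelType.of T S) M (by simpa using hS) (Cardinal.mk_eq_aleph0 M)
  let e' : S ↪ₑ[L] M := Equiv.toElementaryEmbedding e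
  let x : β → S := fun b => ⟨v b, hvS ⟨b, rfl⟩⟩
  refine hM ⟨e' ∘ x, ?_⟩
  rw [typeOf_elementaryEmbedding_comp, ← hv, ← typeOf_elementaryEmbedding_comp S.subtype]
  rfl

/-- The space of types is compact, and it is discrete because all types are isolated. -/
theorem Cardinal.Categorical.finite_completeType [Countable L.Symbols] (hT : T.IsSatisfiable)
    (hinf : ∀ M : ModelType.{0, 0, 0} T, Infinite M) (hcat : Cardinal.aleph0.{0}.Categorical T)
    (β : Type) [Finite β] : Finite (T.CompleteType β) := by
  have : DiscreteTopology (T.CompleteType β) :=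
    discreteTopology_iff_isOpen_singleton.2 fun p => hcat.isOpen_singleton hT hinf p
  exact finite_of_compact_of_discrete

end Categorical

/-! ### ω-categorical groups have finite exponent -/

/-- The term `k • t`. -/
def nsmulTerm {α : Type*} (t : addGroupLang.Term α) : ℕ → addGroupLang.Term α
  | 0 => .func AddGroupFunc.zero Fin.elim0
  | k + 1 => .func AddGroupFunc.add ![nsmulTerm t k, t]

theorem realize_nsmulTerm {α M : Type*} [AddGroup M] (t : addGroupLang.Term α) (v : α → M) (k : ℕ) :
    (nsmulTerm t k).realize v = k • t.realize v := by
  induction k with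
  | zero => exact (zero_nsmul _).symm
  | succ k ih =>
    rw [succ_nsmul, ← ih]
    rfl

instance countable_addGroupLang_symbols : Countable addGroupLang.Symbols := by
  have h : ∀ n, Finite (AddGroupFunc n) := fun n => by
    refine Finite.of_injective (β := Unit) (fun _ => ()) ?_
    rintro (_ | _) g <;> cases g <;> simp
  have h1 : Countable (Σ n, addGroupLang.Functions n) :=
    have : ∀ n, Countable (addGroupLang.Functions n) := fun n => (h n).to_countable
    inferInstance
  have h2 : Countable (Σ n, addGroupLang.Relations n) :=
    have : ∀ n, Countable (addGroupLang.Relations n) := fun n =>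
      inferInstanceAs (Countable Empty)
    inferInstance
  exact inferInstanceAs (Countable (_ ⊕ _))

/-- The type of `(g, k • g)` records that the second entry is `k` times the first, so equal types
for `k` and `l` force `k • g = l • g`. -/
theorem IsOmegaCategorical.exists_exponent {G : Type*} [AddCommGroup G]
    (hG : IsOmegaCategorical addGroupLang G) : ∃ m : ℕ, m ≠ 0 ∧ ∀ g : G, m • g = 0 := by
  cases finite_or_infinite G with
  | inl _ => exact ⟨Nat.card G, Nat.card_pos.ne', fun g => card_nsmul_eq_zero'⟩
  | inr _ =>
    let T := addGroupLang.completeTheory G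
    have hfin : Finite (T.CompleteType (Fin 2)) := hG.finite_completeType
      (FirstOrder.Language.completeTheory.isSatisfiable _ _)
      (fun M => by
        have h : addGroupLang.ElementarilyEquivalent G M :=
          ((FirstOrder.Language.completeTheory.isComplete addGroupLang G).eq_complete_theory G).symm.trans
            ((FirstOrder.Language.completeTheory.isComplete addGroupLang G).eq_complete_theory M)
        exact h.infinite_iff.1 inferInstance) (Fin 2)
    let N := Nat.card (T.CompleteType (Fin 2))
    -- `N` does not depend on `g`. Two of the multiples `0 • g, …, N • g` agree by the pigeonhole
    -- principle, so a positive number at most `N` kills `g`.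
    refine ⟨N.factorial, N.factorial_ne_zero, fun g => ?_⟩
    have hninj : ¬ Function.Injective fun k : Fin (N + 1) =>
        T.typeOf (M := G) ![g, (k : ℕ) • g] := fun h => by
      have : Nat.card (Fin (N + 1)) ≤ N := Nat.card_le_card_of_injective _ h
      rw [Nat.card_fin] at this
      omega
    have key : ∀ k l : ℕ, T.typeOf (M := G) ![g, k • g] = T.typeOf (M := G) ![g, l • g] →
        l • g = k • g := by
      intro k l h
      let φ : addGroupLang.Formula (Fin 2) := (FirstOrder.Language.Term.var 1).equal (nsmulTerm (.var 0) k)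
      have hφ : ∀ l : ℕ, φ.Realize ![g, l • g] ↔ l • g = k • g := fun l => by
        simp [φ, FirstOrder.Language.Formula.realize_equal, realize_nsmulTerm]
      rw [← hφ l]
      rw [← FirstOrder.Language.Theory.CompleteType.formula_mem_typeOf (T := T), ← h,
        FirstOrder.Language.Theory.CompleteType.formula_mem_typeOf, hφ k]
    simp only [Function.Injective, not_forall] at hninj
    obtain ⟨a, b, hab, hne⟩ := hninj
    have main : ∀ a b : ℕ, a < b → b ≤ N → b • g = a • g → N.factorial • g = 0 := by
      intro a b hlt hb h
      have h0 : (b - a) • g = 0 := by rw [sub_nsmul g hlt.le, h, add_neg_cancel]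
      obtain ⟨c, hc⟩ := Nat.dvd_factorial (Nat.sub_pos_of_lt hlt) ((Nat.sub_le b a).trans hb)
      rw [hc, mul_comm, mul_smul, h0, smul_zero]
    have h := key a b hab
    rcases Nat.lt_or_gt_of_ne fun h => hne (Fin.ext h) with hlt | hlt
    · exact main a b hlt (by omega) h
    · exact main b a hlt (by omega) h.symm

/-! ### Composition of transducer runs -/

namespace PassVerifier

variable {Γ Δ Y Q P : Type} (M : PassVerifier Γ Δ Y Q P)

/-- The transducer goes from state `q` and store `s` to `q'` and `s'` while it replaces `l` by `l'`. -/
def Run (q : Q) (s : List P) (l : List Y) (q' : Q) (s' : List P) (l' : List Y) : Prop :=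
  ∀ r, M.scan q s (l ++ r) = ((M.scan q' s' r).1, l' ++ (M.scan q' s' r).2)

variable {M}

theorem Run.nil (q : Q) (s : List P) : M.Run q s [] q s [] := fun _ => rfl

theorem Run.cons {q q' q₁ : Q} {s s' : List P} {y y₁ : Y} {l l' : List Y} {a b : Option P}
    (hd : M.delta q y s.head? = (q₁, y₁, a, b))
    (h : M.Run q₁ (a.toList ++ (b.toList ++ s.tail)) l q' s' l') :
    M.Run q s (y :: l) q' s' (y₁ :: l') := by
  intro r
  simp only [List.cons_append, scan, store, hd]
  rw [h r]

theorem Run.append {q₁ q₂ q₃ : Q} {s₁ s₂ s₃ : List P} {l₁ l₁' l₂ l₂' : List Y}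
    (h₁ : M.Run q₁ s₁ l₁ q₂ s₂ l₁') (h₂ : M.Run q₂ s₂ l₂ q₃ s₃ l₂') :
    M.Run q₁ s₁ (l₁ ++ l₂) q₃ s₃ (l₁' ++ l₂') := by
  intro r
  rw [List.append_assoc, h₁, h₂, List.append_assoc]

theorem Run.flatMap {α : Type*} {q : Q} {s : List P} {f g : α → List Y}
    (h : ∀ a, M.Run q s (f a) q s (g a)) (l : List α) : M.Run q s (l.flatMap f) q s (l.flatMap g) := by
  induction l with
  | nil => exact .nil q s
  | cons a l ih => exact (h a).append ih

theorem Run.scan_eq {q q' : Q} {s s' : List P} {l l' : List Y} (h : M.Run q s l q' s' l') :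
    M.scan q s l = (q', l') := by
  simpa [scan] using h []

end PassVerifier

/-! ### The verifier for abelian groups -/

namespace AddGroupCSP

open PassVerifier

/-- The letters of certificates. The letters `bit` spell the name of a variable, `assign r` assigns
`r` to that variable, and `eval` asks to evaluate the instance. -/
inductive Command (R : Type) : Type
  | bit (b : Bool)
  | assign (r : R)
  | eval

/-- The state during the evaluation of an instance. -/
structure EvalState (R : Type) where
  /-- the left side minus the right side, as far as they are read -/
  sum : R
  /-- whether the right side is being read -/
  right : Bool
  /-- whether no symbol of the current constraint has been read -/
  fresh : Bool
  /-- whether the name of a variable is being read -/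
  name : Bool
  /-- whether the current constraint is an equation -/
  isEq : Bool
  /-- whether all inequations that were read are marked -/
  all : Bool

/-- The state for the current command. -/
inductive Mode (R : Type) : Type
  | bit (b found mismatch : Bool)
  | assign (r : R) (unmatched : Bool)
  | eval (e : EvalState R)

/-- The symbols on the tape: an input symbol together with a mark and a value. The mark of a bit says
whether it is matched, the mark of the end of a variable whether the match failed, and the mark of
a separator whether the inequation before it was found to be true. -/
abbrev TapeSymbol (R : Type) : Type := CSPSymbol addGroupLang × Bool × R

section EvalStep

variable {R : Type} [AddCommGroup R] [DecidableEq R]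

/-- The transducer for evaluation. Terms are in prefix notation; the pushdown store contains the
signs of the terms that are still to be read. -/
def evalStep (e : EvalState R) (m : Bool) (r : R) :
    CSPSymbol addGroupLang → Option Bool → Option (EvalState R × Bool × Option Bool × Option Bool)
  | .func ⟨_, AddGroupFunc.zero⟩, some _ =>
    if e.name then none else some ({ e with fresh := false }, m, none, none)
  | .func ⟨_, AddGroupFunc.neg⟩, some s =>
    if e.name then none else some ({ e with fresh := false }, m, some !s, none)
  | .func ⟨_, AddGroupFunc.add⟩, some s =>
    if e.name then none else some ({ e with fresh := false }, m, some s, some s)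
  -- The sign is put back until the end marker of the name, which carries the value.
  | .bit _, some s => some ({ e with fresh := false, name := true }, m, some s, none)
  | .varEnd, some s =>
    some ({ e with sum := e.sum + (if s then r else -r), fresh := false, name := false }, m, none, none)
  -- An empty store means that the left side is complete; the sign `false` makes the right side be
  -- subtracted.
  | .rel i, none =>
    if e.right then none
    else some ({ e with right := true, isEq := i, fresh := false }, m, some false, none)
  -- A false equation is a failure, whereas a false inequation only stays unmarked, since another
  -- evaluation may make it true.
  | .sep, none =>
    if e.right && (!e.isEq || decide (e.sum = 0)) then
      some ({ sum := 0, right := false, fresh := true, name := false, isEq := false,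
              all := e.all && (e.isEq || (m || !decide (e.sum = 0))) },
        m || (!e.isEq && !decide (e.sum = 0)), some true, none)
    else none
  | _, _ => none

end EvalStep

variable {H K : Type} [AddCommGroup H] [AddCommGroup K] [DecidableEq (H × K)]

/-- The transducer. `none` is the state of failure, and the Boolean in the other states says whether
the first components of values are frozen. -/
def delta (q : Option (Bool × Mode (H × K))) (y : TapeSymbol (H × K)) (p : Option Bool) :
    Option (Bool × Mode (H × K)) × TapeSymbol (H × K) × Option Bool × Option Bool :=
  match q with
  | none => (none, y, p, none)
  | some (z, .bit b found mismatch) =>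
    match y with
    | (.bit c, m, r) =>
      -- In each name only the first unmatched bit is compared with `b`.
      if found || m then (some (z, .bit b found mismatch), (.bit c, m, r), p, none)
      else (some (z, .bit b true (c != b)), (.bit c, c == b, r), p, none)
    | (.varEnd, m, r) =>
      (some (z, .bit b false false), (.varEnd, m || (mismatch || !found), r), p, none)
    | y => (some (z, .bit b found mismatch), y, p, none)
  | some (z, .assign r₀ unmatched) =>
    match y with
    | (.bit c, m, r) => (some (z, .assign r₀ (unmatched || !m)), (.bit c, false, r), p, none)
    | (.varEnd, m, r) =>
      (some (z, .assign r₀ false),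
        -- The name is the spelled one iff no comparison failed and no bit is left over. After
        -- freezing, only the second component changes.
        (.varEnd, false, if m || unmatched then r else if z then (r.1, r₀.2) else r₀), p, none)
    | y => (some (z, .assign r₀ unmatched), y, p, none)
  | some (z, .eval e) =>
    match evalStep e y.2.1 y.2.2 y.1 p with
    | none => (none, y, p, none)
    | some (e', m, s, t) => (some (z, .eval e'), (y.1, m, y.2.2), s, t)

/-- The mode at the beginning of a pass. -/
def Command.mode : Command (H × K) → Mode (H × K)
  | .bit b => .bit b false false
  | .assign r => .assign r false
  | .eval => .eval ⟨0, false, true, false, false, true⟩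

/-- Whether an evaluation has begun. -/
def frozen (z : Bool) : Mode (H × K) → Bool
  | .eval _ => true
  | _ => z

variable (H K) in
/-- The verifier for systems of equations and inequations. -/
def verifier : PassVerifier (CSPSymbol addGroupLang) (Command (H × K)) (TapeSymbol (H × K))
    (Option (Bool × Mode (H × K))) Bool where
  ini g := (g, false, 0)
  init := some (false, .assign 0 false)
  start c q := q.map fun a => (frozen a.1 a.2, c.mode)
  base := true
  delta := delta
  accept
    | some (_, .eval e) => e.fresh && e.all
    | _ => false

/-! #### Annotated instances -/

/-- The constraint tape symbols for a variable whose name is annotated by `t`. -/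
def annotateVar (t : List (Bool × Bool) × Bool) (r : H × K) : List (TapeSymbol (H × K)) :=
  t.1.map (fun x => (.bit x.1, x.2, 0)) ++ [(.varEnd, t.2, r)]

/-- As `a` and `h` depend on the name only, all occurrences of a variable carry the same marks and
the same value. -/
def annotateToken (a : List Bool → List (Bool × Bool) × Bool) (h : List Bool → H × K) :
    List Bool ⊕ (Σ n, addGroupLang.Functions n) → List (TapeSymbol (H × K))
  | .inl n => annotateVar (a n) (h n)
  | .inr f => [(.func f, false, 0)]

def annotateTerm (a : List Bool → List (Bool × Bool) × Bool) (h : List Bool → H × K)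
    (t : addGroupLang.Term (List Bool)) : List (TapeSymbol (H × K)) :=
  t.listEncode.flatMap (annotateToken a h)

def annotateConstraint (a : List Bool → List (Bool × Bool) × Bool) (h : List Bool → H × K)
    (μ : Constraint addGroupLang → Bool) (c : Constraint addGroupLang) :
    List (TapeSymbol (H × K)) :=
  annotateTerm a h c.lhs ++ ([(.rel c.isEq, false, 0)] ++ (annotateTerm a h c.rhs ++ [(.sep, μ c, 0)]))

/-- The tape for the instance `I` whose variables are annotated by `a` and have the values `h`, and
whose constraints have the marks `μ`. -/
def annotate (a : List Bool → List (Bool × Bool) × Bool) (h : List Bool → H × K)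
    (μ : Constraint addGroupLang → Bool) (I : List (Constraint addGroupLang)) :
    List (TapeSymbol (H × K)) :=
  I.flatMap (annotateConstraint a h μ)

/-- The annotation of a variable in which no bit is matched. -/
def unmatched (n : List Bool) : List (Bool × Bool) × Bool := (n.map (·, false), false)

theorem map_ini_encodeInstance (I : List (Constraint addGroupLang)) :
    (encodeInstance I).map (verifier H K).ini = annotate unmatched 0 (fun _ => false) I := by
  have htok : ∀ s, (encodeToken s).map (verifier H K).ini = annotateToken unmatched 0 s := by
    rintro (n | f) <;> simp [encodeToken, annotateToken, annotateVar, unmatched, verifier]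
  have hterm : ∀ t, (encodeTerm t).map (verifier H K).ini = annotateTerm unmatched 0 t := by
    intro t
    rw [encodeTerm, List.map_flatMap, annotateTerm]
    simp only [htok]
  rw [encodeInstance, List.map_flatMap, annotate]
  congr 1
  funext c
  simp only [encodeConstraint, annotateConstraint, List.map_append, List.map_cons, hterm]
  rfl

/-! #### Matching names -/

/-- The run of the transducer on the bits of a name in a pass for `bit b`. -/
def matchBits (b : Bool) : Bool → Bool → List (Bool × Bool) → List (Bool × Bool) × Bool × Bool
  | found, mismatch, [] => ([], found, mismatch)
  | found, mismatch, x :: l =>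
    if found || x.2 then
      (x :: (matchBits b found mismatch l).1, (matchBits b found mismatch l).2)
    else ((x.1, x.1 == b) :: (matchBits b true (x.1 != b) l).1, (matchBits b true (x.1 != b) l).2)

/-- The effect of a pass for `bit b` on a name. -/
def matchName (b : Bool) (t : List (Bool × Bool) × Bool) : List (Bool × Bool) × Bool :=
  ((matchBits b false false t.1).1,
    t.2 || ((matchBits b false false t.1).2.2 || !(matchBits b false false t.1).2.1))

/-- `t` is the annotation of the name `n` after the bits `u` were spelled. -/
def Spelled (u n : List Bool) (t : List (Bool × Bool) × Bool) : Prop :=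
  (∃ v, n = u ++ v ∧ t = (u.map (·, true) ++ v.map (·, false), false)) ∨
    (¬ u <+: n ∧ t.2 = true ∧ t.1.map Prod.fst = n)

theorem spelled_nil_iff {n : List Bool} {t : List (Bool × Bool) × Bool} :
    Spelled [] n t ↔ t = unmatched n := by
  simp [Spelled, unmatched]

theorem map_fst_matchBits (b found mismatch : Bool) (l : List (Bool × Bool)) :
    (matchBits b found mismatch l).1.map Prod.fst = l.map Prod.fst := by
  induction l generalizing found mismatch with
  | nil => rfl
  | cons x l ih =>
    rw [matchBits]
    split <;> simp [ih]

theorem matchBits_found (b mismatch : Bool) (l : List (Bool × Bool)) :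
    matchBits b true mismatch l = (l, true, mismatch) := by
  induction l with
  | nil => rfl
  | cons x l ih => simp [matchBits, ih]

theorem matchBits_append (b mismatch : Bool) (u : List Bool) (l : List (Bool × Bool)) :
    matchBits b false mismatch (u.map (·, true) ++ l) =
      (u.map (·, true) ++ (matchBits b false mismatch l).1, (matchBits b false mismatch l).2) := by
  induction u with
  | nil => rfl
  | cons x u ih => simp [matchBits, ih]

/-- The first unmatched bit agrees with `b`, differs from it, or does not exist. The last two cases
set the failure mark, which then persists. -/
theorem Spelled.matchName {u n : List Bool} {t : List (Bool × Bool) × Bool} (h : Spelled u n t)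
    (b : Bool) : Spelled (u ++ [b]) n (matchName b t) := by
  rcases h with ⟨v, rfl, rfl⟩ | ⟨hu, ht, hn⟩
  · cases v with
    | nil =>
      refine .inr ⟨fun h => ?_, ?_, ?_⟩
      · simpa using h.length_le
      · simp only [AddGroupCSP.matchName, matchBits_append]
        simp [matchBits]
      · simp only [AddGroupCSP.matchName, map_fst_matchBits]
        simp [Function.comp_def]
    | cons c v =>
      by_cases hc : c = b
      · subst hc
        refine .inl ⟨v, by simp, ?_⟩
        simp only [AddGroupCSP.matchName, matchBits_append]
        simp [matchBits, matchBits_found]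
      · refine .inr ⟨fun h => ?_, ?_, ?_⟩
        · rw [List.prefix_append_right_inj] at h
          simp only [List.cons_prefix_cons] at h
          exact hc h.1.symm
        · simp only [AddGroupCSP.matchName, matchBits_append]
          simp [matchBits, matchBits_found, hc]
        · simp only [AddGroupCSP.matchName, map_fst_matchBits]
          simp [Function.comp_def]
  · refine .inr ⟨fun h => hu ((List.prefix_append u [b]).trans h), ?_, ?_⟩
    · simp [AddGroupCSP.matchName, ht]
    · simp only [AddGroupCSP.matchName, map_fst_matchBits, hn]

/-- A pass that returns to the same state and store after every token acts on each token separately.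
-/
theorem run_annotate {q : Option (Bool × Mode (H × K))} {s : List Bool}
    {a a' : List Bool → List (Bool × Bool) × Bool} {h h' : List Bool → H × K}
    (hvar : ∀ n, (verifier H K).Run q s (annotateVar (a n) (h n)) q s (annotateVar (a' n) (h' n)))
    (hsym : ∀ (g : CSPSymbol addGroupLang) (m : Bool), (∀ b, g ≠ .bit b) → g ≠ .varEnd →
      (verifier H K).Run q s [(g, m, 0)] q s [(g, m, 0)])
    (μ : Constraint addGroupLang → Bool) (I : List (Constraint addGroupLang)) :
    (verifier H K).Run q s (annotate a h μ I) q s (annotate a' h' μ I) := by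
  have hterm : ∀ t, (verifier H K).Run q s (annotateTerm a h t) q s (annotateTerm a' h' t) := by
    refine fun t => Run.flatMap ?_ _
    rintro (n | f)
    · exact hvar n
    · exact hsym _ _ (by simp) (by simp)
  exact Run.flatMap (fun c => (hterm _).append ((hsym _ _ (by simp) (by simp)).append
    ((hterm _).append (hsym _ _ (by simp) (by simp))))) _

theorem run_bit (z b : Bool) (s : List Bool) (a : List Bool → List (Bool × Bool) × Bool)
    (h : List Bool → H × K) (μ : Constraint addGroupLang → Bool) (I : List (Constraint addGroupLang)) :
    (verifier H K).Run (some (z, .bit b false false)) s (annotate a h μ I)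
      (some (z, .bit b false false)) s (annotate (matchName b ∘ a) h μ I) := by
  -- Every step pops the store; in these passes the popped symbol is pushed back.
  have hs : s.head?.toList ++ s.tail = s := by cases s <;> rfl
  refine run_annotate (fun n => ?_) (fun g m hg hg' => ?_) μ I
  · have key : ∀ (l : List (Bool × Bool)) (f m : Bool),
        (verifier H K).Run (some (z, .bit b f m)) s (l.map (fun x => (.bit x.1, x.2, 0)))
          (some (z, .bit b (matchBits b f m l).2.1 (matchBits b f m l).2.2)) s
          ((matchBits b f m l).1.map (fun x => (.bit x.1, x.2, 0))) := by
      intro l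
      induction l with
      | nil => exact fun f m => .nil _ _
      | cons x l ih =>
        intro f m
        by_cases hx : (f || x.2) = true
        · have := ih f m
          simp only [matchBits, hx, if_true, List.map_cons]
          refine .cons (a := s.head?) (b := none) ?_ (by simpa [hs] using this)
          simp [verifier, delta, hx]
        · have := ih true (x.1 != b)
          simp only [matchBits, hx, List.map_cons]
          refine .cons (a := s.head?) (b := none) ?_ (by simpa [hs] using this)
          simp [verifier, delta, hx]
    refine (key _ false false).append ?_
    refine .cons (a := s.head?) (b := none) rfl ?_
    simpa [hs] using Run.nil _ _
  · refine .cons (a := s.head?) (b := none) (q₁ := some (z, .bit b false false)) (y₁ := (g, m, 0)) ?_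
      (by simpa [hs] using Run.nil _ _)
    cases g <;> first | rfl | exact absurd rfl (hg _) | exact absurd rfl hg'

theorem run_assign (z : Bool) (r : H × K) (s : List Bool) (a : List Bool → List (Bool × Bool) × Bool)
    (h : List Bool → H × K) (μ : Constraint addGroupLang → Bool) (I : List (Constraint addGroupLang))
    {u : List Bool} (ha : ∀ n, Spelled u n (a n)) :
    (verifier H K).Run (some (z, .assign r false)) s (annotate a h μ I)
      (some (z, .assign r false)) s
      (annotate unmatched (Function.update h u (if z then ((h u).1, r.2) else r)) μ I) := by
  have hs : s.head?.toList ++ s.tail = s := by cases s <;> rfl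
  refine run_annotate (fun n => ?_) (fun g m hg hg' => ?_) μ I
  · have key : ∀ (l : List (Bool × Bool)) (f : Bool),
        (verifier H K).Run (some (z, .assign r f)) s (l.map (fun x => (.bit x.1, x.2, 0)))
          (some (z, .assign r (f || l.any (!·.2)))) s
          ((l.map Prod.fst).map (fun x => (.bit x, false, 0))) := by
      intro l
      induction l with
      | nil => exact fun f => by simpa using Run.nil _ _
      | cons x l ih =>
        intro f
        have := ih (f || !x.2)
        simp only [List.any_cons, List.map_cons, ← Bool.or_assoc]
        refine .cons (a := s.head?) (b := none) ?_ (by simpa [hs] using this)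
        simp [verifier, delta]
    have hrun := (key (a n).1 false).append (.cons (y := (.varEnd, (a n).2, h n))
      (a := s.head?) (b := none) rfl (by simpa [hs] using Run.nil _ _))
    have hname : (a n).1.map Prod.fst = n := by
      rcases ha n with ⟨v, hv, h'⟩ | ⟨-, -, h'⟩
      · rw [h', hv]
        simp [Function.comp_def]
      · exact h'
    -- The condition for writing singles out `n = u`: a proper extension of `u` has unmatched bits,
    -- and a name that does not extend `u` has the failure mark.
    have hval : (if ((a n).2 || (false || (a n).1.any (!·.2))) = true then h n
        else if z then ((h n).1, r.2) else r) =
        Function.update h u (if z then ((h u).1, r.2) else r) n := by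
      rcases ha n with ⟨v, rfl, h'⟩ | ⟨hu, h', -⟩
      · cases v with
        | nil =>
          rw [h']
          simp
        | cons c v => simp [h', Function.update_of_ne]
      · have : n ≠ u := fun h => hu (h ▸ List.prefix_rfl)
        simp [h', Function.update_of_ne this]
    rw [hname, hval] at hrun
    simpa [annotateVar, unmatched, Function.comp_def] using hrun
  · refine .cons (a := s.head?) (b := none) (q₁ := some (z, .assign r false)) (y₁ := (g, m, 0)) ?_
      (by simpa [hs] using Run.nil _ _)
    cases g <;> first | rfl | exact absurd rfl (hg _) | exact absurd rfl hg'

/-! #### Evaluation of instances -/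

/-- By induction on the term: it consumes one sign and adds its signed value to the sum. Negation
replaces the sign by its opposite, and addition duplicates it for the two arguments. -/
theorem run_readTerm (z : Bool) (a : List Bool → List (Bool × Bool) × Bool) (h : List Bool → H × K)
    (t : addGroupLang.Term (List Bool)) (e : EvalState (H × K)) (he : e.name = false) (s : Bool)
    (S : List Bool) :
    (verifier H K).Run (some (z, .eval e)) (s :: S) (annotateTerm a h t)
      (some (z, .eval { e with sum := e.sum + (if s then t.realize h else -t.realize h),
                               fresh := false })) S (annotateTerm a h t) := by
  induction t generalizing e s S with
  | var n =>
    have key : ∀ (l : List (Bool × Bool)), (verifier H K).Run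
        (some (z, .eval { e with fresh := false, name := true })) (s :: S)
        (l.map (fun x => (.bit x.1, x.2, 0)))
        (some (z, .eval { e with fresh := false, name := true })) (s :: S)
        (l.map (fun x => (.bit x.1, x.2, 0))) := by
      intro l
      induction l with
      | nil => exact .nil _ _
      | cons x l ih => exact .cons (a := some s) (b := none) rfl ih
    have hlast : ∀ e' : EvalState (H × K), (verifier H K).Run (some (z, .eval e')) (s :: S)
        [(.varEnd, (a n).2, h n)]
        (some (z, .eval { e' with sum := e'.sum + (if s then h n else -h n), fresh := false,
                                  name := false })) S [(.varEnd, (a n).2, h n)] := fun e' =>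
      .cons (a := none) (b := none) rfl (.nil _ _)
    simp only [annotateTerm, FirstOrder.Language.Term.listEncode, List.flatMap_cons, List.flatMap_nil,
      List.append_nil, annotateToken, annotateVar]
    cases hl : (a n).1 with
    | nil =>
      obtain ⟨sum, right, fresh, name, isEq, all⟩ := e
      obtain rfl : name = false := he
      exact hlast _
    | cons x l =>
      have h₁ : (verifier H K).Run (some (z, .eval e)) (s :: S)
          ((x :: l).map (fun x => (.bit x.1, x.2, 0)))
          (some (z, .eval { e with fresh := false, name := true })) (s :: S)
          ((x :: l).map (fun x => (.bit x.1, x.2, 0))) :=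
        .cons (a := some s) (b := none) rfl (key l)
      have h₂ := h₁.append (hlast _)
      obtain ⟨sum, right, fresh, name, isEq, all⟩ := e
      obtain rfl : name = false := he
      exact h₂
  | func f ts ih =>
    cases f with
    | zero =>
      refine .cons (a := none) (b := none) (q₁ := some (z, .eval { e with fresh := false })) ?_ ?_
      · simp [verifier, delta, evalStep, he]
      · have h0 : (FirstOrder.Language.Term.func AddGroupFunc.zero ts : addGroupLang.Term _).realize h = 0 := rfl
        rw [h0, neg_zero, ite_self, add_zero]
        exact .nil _ _
    | neg =>
      have h1 : (FirstOrder.Language.Term.func AddGroupFunc.neg ts : addGroupLang.Term _).realize h =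
        -(ts 0).realize h := rfl
      have h2 : annotateTerm a h (FirstOrder.Language.Term.func AddGroupFunc.neg ts) =
          (.func ⟨1, AddGroupFunc.neg⟩, false, 0) :: annotateTerm a h (ts 0) := by
        simp [annotateTerm, FirstOrder.Language.Term.listEncode, annotateToken, List.finRange_succ]
      rw [h1, h2]
      refine .cons (a := some !s) (b := none) (q₁ := some (z, .eval { e with fresh := false })) ?_ ?_
      · simp [verifier, delta, evalStep, he]
      · have := ih 0 { e with fresh := false } he (!s) S
        cases s <;> simpa using this
    | add =>
      have h1 : (FirstOrder.Language.Term.func AddGroupFunc.add ts : addGroupLang.Term _).realize h =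
        (ts 0).realize h + (ts 1).realize h := rfl
      have h2 : annotateTerm a h (FirstOrder.Language.Term.func AddGroupFunc.add ts) =
          (.func ⟨2, AddGroupFunc.add⟩, false, 0) :: (annotateTerm a h (ts 0) ++ annotateTerm a h (ts 1)) := by
        simp [annotateTerm, FirstOrder.Language.Term.listEncode, annotateToken, List.finRange_succ]
      rw [h1, h2]
      refine .cons (a := some s) (b := some s) (q₁ := some (z, .eval { e with fresh := false })) ?_ ?_
      · simp [verifier, delta, evalStep, he]
      · have h3 := (ih 0 { e with fresh := false } he s (s :: S)).append (ih 1
          { e with sum := e.sum + (if s then (ts 0).realize h else -(ts 0).realize h), fresh := false }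
          he s S)
        have h4 : e.sum + (if s then (ts 0).realize h else -(ts 0).realize h) +
            (if s then (ts 1).realize h else -(ts 1).realize h) =
            e.sum + (if s then (ts 0).realize h + (ts 1).realize h
              else -((ts 0).realize h + (ts 1).realize h)) := by
          cases s
          · simp only [Bool.false_eq_true, if_false, neg_add, add_assoc]
          · simp only [if_true, add_assoc]
        simp only [h4] at h3
        exact h3

/-- The state of the evaluation at the beginning of a constraint. -/
def evalStart (al : Bool) : EvalState (H × K) := ⟨0, false, true, false, false, al⟩

open Classical in
/-- The marks after an evaluation. -/
noncomputable def updateMarks (h : List Bool → H × K) (μ : Constraint addGroupLang → Bool)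
    (c : Constraint addGroupLang) : Bool :=
  μ c || (!c.isEq && decide (c.Holds h))

theorem run_readSides (z al : Bool) (a : List Bool → List (Bool × Bool) × Bool) (h : List Bool → H × K)
    (c : Constraint addGroupLang) :
    (verifier H K).Run (some (z, .eval (evalStart al))) [true]
      (annotateTerm a h c.lhs ++ ([(.rel c.isEq, false, 0)] ++ annotateTerm a h c.rhs))
      (some (z, .eval ⟨c.lhs.realize h - c.rhs.realize h, true, false, false, c.isEq, al⟩)) []
      (annotateTerm a h c.lhs ++ ([(.rel c.isEq, false, 0)] ++ annotateTerm a h c.rhs)) := by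
  refine (run_readTerm z a h c.lhs (evalStart al) rfl true []).append ?_
  refine .cons (a := some false) (b := none)
    (q₁ := some (z, .eval ⟨c.lhs.realize h, true, false, false, c.isEq, al⟩)) ?_ ?_
  · simp [verifier, delta, evalStep, evalStart]
  · have := run_readTerm z a h c.rhs ⟨c.lhs.realize h, true, false, false, c.isEq, al⟩ rfl false []
    simpa [sub_eq_add_neg] using this

/-- The separator restores the initial sum and store, so that constraints are evaluated
independently except for the flag `al`. -/
theorem run_evalConstraint (z al : Bool) (a : List Bool → List (Bool × Bool) × Bool)
    (h : List Bool → H × K) (μ : Constraint addGroupLang → Bool) (c : Constraint addGroupLang)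
    (hc : c.isEq = true → c.Holds h) :
    (verifier H K).Run (some (z, .eval (evalStart al))) [true] (annotateConstraint a h μ c)
      (some (z, .eval (evalStart (al && (c.isEq || updateMarks h μ c))))) [true]
      (annotateConstraint a h (updateMarks h μ) c) := by
  have h₁ := (run_readSides z al a h c).append (.cons (y := (.sep, μ c, 0)) (a := some true) (b := none)
    (q₁ := some (z, .eval (evalStart (al && (c.isEq || updateMarks h μ c)))))
    (y₁ := (.sep, updateMarks h μ c, 0)) ?_ (.nil _ _))
  · simpa [annotateConstraint] using h₁
  · cases he : c.isEq
    · simp [verifier, delta, evalStep, evalStart, updateMarks, he, Constraint.Holds, sub_eq_zero]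
    · have : c.lhs.realize h - c.rhs.realize h = 0 := by
        have := hc he
        simpa [Constraint.Holds, he, sub_eq_zero] using this
      simp [verifier, delta, evalStep, evalStart, updateMarks, he, this]

theorem scan_none (s : List Bool) (l : List (TapeSymbol (H × K))) :
    ((verifier H K).scan none s l).1 = none := by
  induction l generalizing s with
  | nil => rfl
  | cons y l ih => exact ih _

theorem run_evalConstraint_of_not_holds (z al : Bool) (a : List Bool → List (Bool × Bool) × Bool)
    (h : List Bool → H × K) (μ : Constraint addGroupLang → Bool) (c : Constraint addGroupLang)
    (he : c.isEq = true) (hc : ¬ c.Holds h) (r : List (TapeSymbol (H × K))) :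
    ((verifier H K).scan (some (z, .eval (evalStart al))) [true] (annotateConstraint a h μ c ++ r)).1 =
      none := by
  have h₁ := run_readSides z al a h c ([(.sep, μ c, 0)] ++ r)
  have h₂ : c.lhs.realize h - c.rhs.realize h ≠ 0 := by
    simpa [Constraint.Holds, he, sub_eq_zero] using hc
  have h₃ : annotateConstraint a h μ c ++ r = (annotateTerm a h c.lhs ++
      ([(.rel c.isEq, false, 0)] ++ annotateTerm a h c.rhs)) ++ ([(.sep, μ c, 0)] ++ r) := by
    simp [annotateConstraint]
  rw [h₃, h₁]
  have h₄ : (verifier H K).delta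
      (some (z, .eval ⟨c.lhs.realize h - c.rhs.realize h, true, false, false, c.isEq, al⟩))
      (.sep, μ c, 0) none = (none, (.sep, μ c, 0), none, none) := by
    simp [verifier, delta, evalStep, he, h₂]
  simp only [List.singleton_append, scan, List.head?_nil, h₄]
  exact scan_none _ _

theorem run_eval (z al : Bool) (a : List Bool → List (Bool × Bool) × Bool)
    (h : List Bool → H × K) (μ : Constraint addGroupLang → Bool) (I : List (Constraint addGroupLang))
    (hI : ∀ c ∈ I, c.isEq = true → c.Holds h) :
    (verifier H K).Run (some (z, .eval (evalStart al))) [true] (annotate a h μ I)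
      (some (z, .eval (evalStart (al && I.all fun c => c.isEq || updateMarks h μ c)))) [true]
      (annotate a h (updateMarks h μ) I) := by
  induction I generalizing al with
  | nil => simpa [annotate] using Run.nil _ _
  | cons c I ih =>
    have h₁ := (run_evalConstraint z al a h μ c (hI c List.mem_cons_self)).append
      (ih (al && (c.isEq || updateMarks h μ c)) fun d hd => hI d (List.mem_cons_of_mem _ hd))
    simpa only [annotate, List.flatMap_cons, List.all_cons, Bool.and_assoc] using h₁

/-- Evaluation runs normally up to the first false equation and fails there; failure is permanent.
-/
theorem scan_eval_eq_none (z al : Bool) (a : List Bool → List (Bool × Bool) × Bool)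
    (h : List Bool → H × K) (μ : Constraint addGroupLang → Bool) (I : List (Constraint addGroupLang))
    {c : Constraint addGroupLang} (hc : c ∈ I) (he : c.isEq = true) (hch : ¬ c.Holds h) :
    ((verifier H K).scan (some (z, .eval (evalStart al))) [true] (annotate a h μ I)).1 = none := by
  induction I generalizing al with
  | nil => simp at hc
  | cons d I ih =>
    by_cases hd : d.isEq = true ∧ ¬ d.Holds h
    · exact run_evalConstraint_of_not_holds z al a h μ d hd.1 hd.2 _
    · have h₁ := run_evalConstraint z al a h μ d (fun h => by_contra fun h' => hd ⟨h, h'⟩)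
        (annotate a h μ I)
      refine (congrArg Prod.fst h₁).trans (ih _ ?_)
      rcases List.mem_cons.1 hc with rfl | hc
      · exact absurd ⟨he, hch⟩ hd
      · exact hc

/-! #### Only instances are accepted -/

/-- Passes change only marks and values, so a later evaluation still parses the original word. -/
theorem map_fst_scan (q : Option (Bool × Mode (H × K))) (s : List Bool)
    (l : List (TapeSymbol (H × K))) : ((verifier H K).scan q s l).2.map Prod.fst = l.map Prod.fst := by
  have hd : ∀ (q : Option (Bool × Mode (H × K))) (y : TapeSymbol (H × K)) (p : Option Bool),
      (delta q y p).2.1.1 = y.1 := by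
    intro q y p
    unfold delta
    split
    · rfl
    · split <;> [split; skip; skip] <;> rfl
    · split <;> rfl
    · split <;> rfl
  induction l generalizing q s with
  | nil => rfl
  | cons y l ih =>
    simp only [scan, List.map_cons, ih]
    exact congrArg (· :: _) (hd _ _ _)

/-- The evaluation that continues from the given state and store succeeds. -/
def Succeeds (z : Bool) (e : EvalState (H × K)) (s : List Bool) (l : List (TapeSymbol (H × K))) : Prop :=
  ∃ z' e', ((verifier H K).scan (some (z, .eval e)) s l).1 = some (z', .eval e') ∧ e'.fresh = true

theorem Succeeds.fresh {z : Bool} {e : EvalState (H × K)} {s : List Bool} (h : Succeeds z e s []) :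
    e.fresh = true := by
  obtain ⟨z', e', h, hf⟩ := h
  simp only [scan, Option.some.injEq, Prod.mk.injEq, Mode.eval.injEq] at h
  rw [h.2, hf]

theorem Succeeds.cons {z : Bool} {e : EvalState (H × K)} {s : List Bool} {y : TapeSymbol (H × K)}
    {l : List (TapeSymbol (H × K))} (h : Succeeds z e s (y :: l)) :
    ∃ e' m p q, evalStep e y.2.1 y.2.2 y.1 s.head? = some (e', m, p, q) ∧
      Succeeds z e' (p.toList ++ (q.toList ++ s.tail)) l := by
  obtain ⟨z', e', h, hf⟩ := h
  cases hs : evalStep e y.2.1 y.2.2 y.1 s.head? with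
  | none =>
    have hd : (verifier H K).delta (some (z, .eval e)) y s.head? = (none, y, s.head?, none) := by
      simp [verifier, delta, hs]
    simp [scan, hd, scan_none] at h
  | some u =>
    obtain ⟨e₁, m, p, q⟩ := u
    have hd : (verifier H K).delta (some (z, .eval e)) y s.head? =
        (some (z, .eval e₁), (y.1, m, y.2.2), p, q) := by
      simp [verifier, delta, hs]
    simp only [scan, hd, store] at h
    exact ⟨e₁, m, p, q, rfl, z', e', h, hf⟩

theorem encodeTerm_zero (ts : Fin 0 → addGroupLang.Term (List Bool)) :
    encodeTerm (L := addGroupLang) (.func AddGroupFunc.zero ts) = [.func ⟨0, AddGroupFunc.zero⟩] := rfl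

theorem encodeTerm_neg (t : addGroupLang.Term (List Bool)) :
    encodeTerm (L := addGroupLang) (.func AddGroupFunc.neg ![t]) =
      .func ⟨1, AddGroupFunc.neg⟩ :: encodeTerm t := by
  simp [encodeTerm, FirstOrder.Language.Term.listEncode, encodeToken, List.finRange_succ]

theorem encodeTerm_add (t t' : addGroupLang.Term (List Bool)) :
    encodeTerm (L := addGroupLang) (.func AddGroupFunc.add ![t, t']) =
      .func ⟨2, AddGroupFunc.add⟩ :: (encodeTerm t ++ encodeTerm t') := by
  simp [encodeTerm, FirstOrder.Language.Term.listEncode, encodeToken, List.finRange_succ]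

theorem Succeeds.exists_variable {z : Bool} {e : EvalState (H × K)} {s : Bool} {S : List Bool}
    {l : List (TapeSymbol (H × K))} (h : Succeeds z e (s :: S) l) (hn : e.name = true)
    (hf : e.fresh = false) :
    ∃ (n : List Bool) (r : List (TapeSymbol (H × K))) (e' : EvalState (H × K)),
      l.map Prod.fst = n.map .bit ++ .varEnd :: r.map Prod.fst ∧ r.length < l.length ∧
        Succeeds z e' S r ∧ e'.name = false ∧ e'.fresh = false ∧ e'.right = e.right := by
  induction l generalizing e with
  | nil => simp [h.fresh] at hf
  | cons y l ih =>
    obtain ⟨e', m, p, q, hs, h'⟩ := h.cons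
    obtain ⟨g, m', r⟩ := y
    cases g with
    | func f =>
      obtain ⟨n, f⟩ := f
      cases f <;> simp [evalStep, hn] at hs
    | bit b =>
      simp only [evalStep, List.head?_cons, Option.some.injEq, Prod.mk.injEq] at hs
      obtain ⟨rfl, -, rfl, rfl⟩ := hs
      obtain ⟨n, r, e₁, h₁, h₂, h₃⟩ := ih h' rfl rfl
      exact ⟨b :: n, r, e₁, by simp [h₁], by simp; omega, h₃⟩
    | varEnd =>
      simp only [evalStep, List.head?_cons, Option.some.injEq, Prod.mk.injEq] at hs
      obtain ⟨rfl, -, rfl, rfl⟩ := hs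
      exact ⟨[], l, _, by simp, by simp, h', rfl, rfl, rfl⟩
    | rel i => simp [evalStep] at hs
    | sep => simp [evalStep] at hs

/-- The store dictates which terms must follow, so success yields a parse. The induction is on a
length bound because the second summand begins in whatever the first one leaves. `hf` excludes the
empty tape, on which success is trivial. -/
theorem Succeeds.exists_term (N : ℕ) {z : Bool} {e : EvalState (H × K)} {s : Bool} {S : List Bool}
    {l : List (TapeSymbol (H × K))} (hl : l.length ≤ N) (h : Succeeds z e (s :: S) l)
    (hn : e.name = false) (hf : l ≠ [] ∨ e.fresh = false) :
    ∃ (t : addGroupLang.Term (List Bool)) (r : List (TapeSymbol (H × K))) (e' : EvalState (H × K)),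
      l.map Prod.fst = encodeTerm t ++ r.map Prod.fst ∧ r.length < l.length ∧
        Succeeds z e' S r ∧ e'.name = false ∧ e'.fresh = false ∧ e'.right = e.right := by
  induction N generalizing l e s S with
  | zero =>
    obtain rfl : l = [] := List.length_eq_zero_iff.1 (Nat.le_zero.1 hl)
    simp [h.fresh] at hf
  | succ N ih =>
    cases l with
    | nil => simp [h.fresh] at hf
    | cons y l =>
      have hlN : l.length ≤ N := by simpa using hl
      obtain ⟨e', m, p, q, hs, h'⟩ := h.cons
      obtain ⟨g, m', r⟩ := y
      cases g with
      | func f =>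
        obtain ⟨n, f⟩ := f
        cases f with
        | zero =>
          simp only [evalStep, List.head?_cons, hn, Bool.false_eq_true, if_false, Option.some.injEq,
            Prod.mk.injEq] at hs
          obtain ⟨rfl, -, rfl, rfl⟩ := hs
          exact ⟨.func AddGroupFunc.zero Fin.elim0, l, _, by simp [encodeTerm_zero], by simp, h', rfl,
            rfl, rfl⟩
        | neg =>
          simp only [evalStep, List.head?_cons, hn, Bool.false_eq_true, if_false, Option.some.injEq,
            Prod.mk.injEq] at hs
          obtain ⟨rfl, -, rfl, rfl⟩ := hs
          obtain ⟨t, r, e₁, h₁, h₂, h₃, h₄, h₅, h₆⟩ := ih hlN h' rfl (.inr rfl)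
          exact ⟨.func AddGroupFunc.neg ![t], r, e₁, by simp [encodeTerm_neg, h₁],
            by simp; omega, h₃, h₄, h₅, h₆⟩
        | add =>
          simp only [evalStep, List.head?_cons, hn, Bool.false_eq_true, if_false, Option.some.injEq,
            Prod.mk.injEq] at hs
          obtain ⟨rfl, -, rfl, rfl⟩ := hs
          obtain ⟨t, r, e₁, h₁, h₂, h₃, h₄, h₅, h₆⟩ := ih hlN h' rfl (.inr rfl)
          obtain ⟨t', r', e₁', h₁', h₂', h₃', h₄', h₅', h₆'⟩ := ih (by omega) h₃ h₄ (.inr h₅)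
          exact ⟨.func AddGroupFunc.add ![t, t'], r', e₁',
            by simp [encodeTerm_add, h₁, h₁'],
            by simp; omega, h₃', h₄', h₅', h₆'.trans h₆⟩
      | bit b =>
        simp only [evalStep, List.head?_cons, Option.some.injEq, Prod.mk.injEq] at hs
        obtain ⟨rfl, -, rfl, rfl⟩ := hs
        obtain ⟨n, r, e₁, h₁, h₂, h₃⟩ := h'.exists_variable rfl rfl
        exact ⟨.var (b :: n), r, e₁,
          by simp [h₁, encodeTerm, FirstOrder.Language.Term.listEncode, encodeToken],
          by simp; omega, h₃⟩
      | varEnd =>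
        simp only [evalStep, List.head?_cons, Option.some.injEq, Prod.mk.injEq] at hs
        obtain ⟨rfl, -, rfl, rfl⟩ := hs
        exact ⟨.var [], l, _, by simp [encodeTerm, FirstOrder.Language.Term.listEncode, encodeToken],
          by simp, h', rfl, rfl, rfl⟩
      | rel i => simp [evalStep] at hs
      | sep => simp [evalStep] at hs

theorem Succeeds.exists_instance (N : ℕ) {z : Bool} {e : EvalState (H × K)}
    {l : List (TapeSymbol (H × K))} (hl : l.length ≤ N) (h : Succeeds z e [true] l)
    (hn : e.name = false) (hr : e.right = false) :
    ∃ I : List (Constraint addGroupLang), encodeInstance I = l.map Prod.fst := by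
  induction N generalizing l e with
  | zero =>
    obtain rfl : l = [] := List.length_eq_zero_iff.1 (Nat.le_zero.1 hl)
    exact ⟨[], rfl⟩
  | succ N ih =>
    by_cases hl0 : l = []
    · exact ⟨[], by simp [hl0, encodeInstance]⟩
    obtain ⟨t, r, e₁, h₁, h₂, h₃, h₄, h₅, h₆⟩ := h.exists_term _ le_rfl hn (.inl hl0)
    cases r with
    | nil => simp [h₃.fresh] at h₅
    | cons y r =>
      obtain ⟨e₂, m, p, q, hs, h₇⟩ := h₃.cons
      obtain ⟨g, m', v⟩ := y
      obtain ⟨i, rfl⟩ : ∃ i, g = .rel i := by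
        cases g with
        | func f =>
          obtain ⟨n, f⟩ := f
          cases f <;> simp [evalStep] at hs
        | bit b => simp [evalStep] at hs
        | varEnd => simp [evalStep] at hs
        | rel i => exact ⟨i, rfl⟩
        | sep => simp [evalStep, h₆, hr] at hs
      simp only [evalStep, List.head?_nil, h₆, hr, Bool.false_eq_true, if_false, Option.some.injEq,
        Prod.mk.injEq] at hs
      obtain ⟨rfl, -, rfl, rfl⟩ := hs
      obtain ⟨t', r', e₁', h₁', h₂', h₃', h₄', h₅', h₆'⟩ := h₇.exists_term _ le_rfl h₄ (.inr rfl)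
      cases r' with
      | nil => simp [h₃'.fresh] at h₅'
      | cons y r' =>
        replace h₃' : Succeeds z e₁' [] (y :: r') := h₃'
        obtain ⟨e₃, m'', p, q, hs, h₈⟩ := h₃'.cons
        obtain ⟨g, m₁, v'⟩ := y
        obtain rfl : g = .sep := by
          cases g with
          | func f =>
            obtain ⟨n, f⟩ := f
            cases f <;> simp [evalStep] at hs
          | bit b => simp [evalStep] at hs
          | varEnd => simp [evalStep] at hs
          | rel i => simp [evalStep, h₆'] at hs
          | sep => rfl
        simp only [evalStep, List.head?_nil] at hs
        split at hs
        · simp only [Option.some.injEq, Prod.mk.injEq] at hs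
          obtain ⟨rfl, -, rfl, rfl⟩ := hs
          obtain ⟨I, hI⟩ := ih (by simp at h₂ h₂'; omega) h₈ rfl rfl
          refine ⟨⟨t, i, t'⟩ :: I, ?_⟩
          have : encodeInstance (⟨t, i, t'⟩ :: I) = encodeConstraint ⟨t, i, t'⟩ ++ encodeInstance I := rfl
          rw [this, hI, h₁, List.map_cons, h₁', encodeConstraint]
          simp
        · simp at hs

/-- Only evaluation states accept, and no pass of another kind enters one. -/
theorem accept_scan_eq_false (q : Option (Bool × Mode (H × K))) (hq : ∀ z e, q ≠ some (z, .eval e))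
    (s : List Bool) (l : List (TapeSymbol (H × K))) :
    (verifier H K).accept ((verifier H K).scan q s l).1 = false := by
  have hd : ∀ (q : Option (Bool × Mode (H × K))) (y : TapeSymbol (H × K)) (p : Option Bool),
      (∀ z e, q ≠ some (z, .eval e)) → ∀ z e, (delta q y p).1 ≠ some (z, .eval e) := by
    intro q y p hq
    unfold delta
    split
    · simp
    · split <;> [split; skip; skip] <;> simp
    · split <;> simp
    · exact absurd rfl (hq _ _)
  induction l generalizing q s with
  | nil =>
    rcases q with _ | ⟨z, b | r | e⟩
    · rfl
    · rfl
    · rfl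
    · exact absurd rfl (hq z e)
  | cons y l ih => exact ih _ (hd _ _ _ hq) _

theorem map_fst_foldl_pass (w : List (Command (H × K)))
    (p : Option (Bool × Mode (H × K)) × List (TapeSymbol (H × K))) :
    (w.foldl (verifier H K).pass p).2.map Prod.fst = p.2.map Prod.fst := by
  induction w generalizing p with
  | nil => rfl
  | cons c w ih => exact (ih _).trans (map_fst_scan _ _ _)

/-- The last letter of an accepted certificate is `eval`, and the pass for it parses the word. -/
theorem exists_encodeInstance_eq_of_verdict {x : List (CSPSymbol addGroupLang)}
    {w : List (Command (H × K))} (h : (verifier H K).verdict (x, w) = true) :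
    ∃ I : List (Constraint addGroupLang), encodeInstance I = x := by
  rcases w.eq_nil_or_concat with rfl | ⟨w, c, rfl⟩
  · simp [verdict, verifier] at h
  have hx := map_fst_foldl_pass w ((verifier H K).init, x.map (verifier H K).ini)
  have hx' : (x.map (verifier H K).ini).map Prod.fst = x := by
    simp [verifier, Function.comp_def]
  simp only [verdict, List.concat_eq_append, List.foldl_append, List.foldl_cons, List.foldl_nil] at h
  rw [hx'] at hx
  generalize w.foldl (verifier H K).pass ((verifier H K).init, x.map (verifier H K).ini) = p at h hx
  have hc : c = .eval := by
    by_contra hc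
    unfold PassVerifier.pass at h
    rw [accept_scan_eq_false] at h
    · cases h
    · intro z e he
      obtain ⟨a, -, ha⟩ := Option.map_eq_some_iff.1 he
      cases c <;> simp_all [Command.mode]
  obtain ⟨q, l⟩ := p
  subst hc
  cases q with
  | none =>
    have : (verifier H K).pass (none, l) .eval = (verifier H K).scan none [true] l := rfl
    rw [this, scan_none] at h
    cases h
  | some a =>
    have hp : (verifier H K).pass (some a, l) .eval =
      (verifier H K).scan (some (frozen a.1 a.2, .eval (evalStart true))) [true] l := rfl
    rw [hp] at h
    have hs : Succeeds (frozen a.1 a.2) (evalStart true) [true] l := by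
      unfold Succeeds
      generalize ((verifier H K).scan (some (frozen a.1 a.2, .eval (evalStart true))) [true] l).1 = q at h
      rcases q with _ | ⟨z, b | r | e⟩
      · cases h
      · cases h
      · cases h
      · exact ⟨z, e, rfl, (Bool.and_eq_true_iff.1 h).1⟩
    obtain ⟨I, hI⟩ := hs.exists_instance _ le_rfl rfl rfl
    exact ⟨I, hI.trans hx⟩

/-! #### Configurations between two passes -/

/-- The bits `u` are spelled, the variables have the values `h`, the constraints have the marks `μ`,
and `z` says whether an evaluation has taken place. -/
def Config (z : Bool) (u : List Bool) (h : List Bool → H × K) (μ : Constraint addGroupLang → Bool)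
    (I : List (Constraint addGroupLang))
    (p : Option (Bool × Mode (H × K)) × List (TapeSymbol (H × K))) : Prop :=
  ∃ z' m a, p = (some (z', m), annotate a h μ I) ∧ frozen z' m = z ∧ ∀ n, Spelled u n (a n)

variable {z : Bool} {u : List Bool} {h : List Bool → H × K} {μ : Constraint addGroupLang → Bool}
  {I : List (Constraint addGroupLang)}
  {p : Option (Bool × Mode (H × K)) × List (TapeSymbol (H × K))}

theorem config_init (I : List (Constraint addGroupLang)) :
    Config false [] 0 (fun _ => false) I
      ((verifier H K).init, (encodeInstance I).map (verifier H K).ini) :=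
  ⟨false, .assign 0 false, unmatched, by rw [map_ini_encodeInstance]; rfl, rfl,
    fun _ => spelled_nil_iff.2 rfl⟩

theorem Config.bit (hp : Config z u h μ I p) (b : Bool) :
    Config z (u ++ [b]) h μ I ((verifier H K).pass p (.bit b)) ∧
      (verifier H K).accept ((verifier H K).pass p (.bit b)).1 = false := by
  obtain ⟨z', m, a, rfl, rfl, ha⟩ := hp
  have hr := (run_bit (frozen z' m) b [true] a h μ I).scan_eq
  have hq : (verifier H K).pass (some (z', m), annotate a h μ I) (.bit b) =
    (some (frozen z' m, .bit b false false), annotate (matchName b ∘ a) h μ I) := hr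
  rw [hq]
  exact ⟨⟨_, _, _, rfl, rfl, fun n => (ha n).matchName b⟩, rfl⟩

theorem Config.assign (hp : Config z u h μ I p) (r : H × K) :
    Config z [] (Function.update h u (if z then ((h u).1, r.2) else r)) μ I
        ((verifier H K).pass p (.assign r)) ∧
      (verifier H K).accept ((verifier H K).pass p (.assign r)).1 = false := by
  obtain ⟨z', m, a, rfl, rfl, ha⟩ := hp
  have hr := (run_assign (frozen z' m) r [true] a h μ I ha).scan_eq
  have hq : (verifier H K).pass (some (z', m), annotate a h μ I) (.assign r) =
    (some (frozen z' m, .assign r false), _) := hr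
  rw [hq]
  exact ⟨⟨_, _, _, rfl, rfl, fun n => spelled_nil_iff.2 rfl⟩, rfl⟩

theorem Config.eval (hp : Config z u h μ I p) (hI : ∀ c ∈ I, c.isEq = true → c.Holds h) :
    Config true u h (updateMarks h μ) I ((verifier H K).pass p .eval) ∧
      (verifier H K).accept ((verifier H K).pass p .eval).1 =
        I.all fun c => c.isEq || updateMarks h μ c := by
  obtain ⟨z', m, a, rfl, rfl, ha⟩ := hp
  have hr := (run_eval (frozen z' m) true a h μ I hI).scan_eq
  have hq : (verifier H K).pass (some (z', m), annotate a h μ I) .eval =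
    (some (frozen z' m, .eval (evalStart (true && I.all fun c => c.isEq || updateMarks h μ c))),
      annotate a h (updateMarks h μ) I) := hr
  rw [hq]
  exact ⟨⟨_, _, _, rfl, rfl, ha⟩, by simp [verifier, evalStart]⟩

theorem Config.eval_eq_none (hp : Config z u h μ I p) {c : Constraint addGroupLang} (hc : c ∈ I)
    (he : c.isEq = true) (hch : ¬ c.Holds h) : ((verifier H K).pass p .eval).1 = none := by
  obtain ⟨z', m, a, rfl, rfl, ha⟩ := hp
  exact scan_eval_eq_none _ _ _ _ _ _ hc he hch

/-! #### Accepted instances have witnesses -/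

theorem foldl_pass_none (w : List (Command (H × K))) (hp : p.1 = none) :
    (w.foldl (verifier H K).pass p).1 = none := by
  induction w generalizing p with
  | nil => exact hp
  | cons c w ih =>
    refine ih ?_
    unfold PassVerifier.pass
    rw [hp]
    exact scan_none _ _

/-- If a run that starts in a configuration that is justified by `ks` accepts, then there are
witnesses. -/
theorem Config.exists_witnesses (w : List (Command (H × K))) (hp : Config z u h μ I p)
    (ks : List (List Bool → K))
    (hks : ∀ k ∈ ks, ∀ c ∈ I, c.isEq = true → c.Holds fun x => ((h x).1, k x))
    (hμ : ∀ c ∈ I, c.isEq = false → μ c = true → ∃ k ∈ ks, c.Holds fun x => ((h x).1, k x))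
    (hz : z = false → ks = [])
    (hacc : (verifier H K).accept p.1 = true → ks ≠ [] ∧ ∀ c ∈ I, c.isEq = false → μ c = true)
    (hw : (verifier H K).accept (w.foldl (verifier H K).pass p).1 = true) :
    ∃ (f : List Bool → H) (ks : List (List Bool → K)), ks ≠ [] ∧ Witnesses I f ks := by
  induction w generalizing z u h μ p ks with
  | nil =>
    obtain ⟨h₁, h₂⟩ := hacc hw
    exact ⟨fun x => (h x).1, ks, h₁, hks, fun c hc he => hμ c hc he (h₂ c hc he)⟩
  | cons c w ih =>
    rw [List.foldl_cons] at hw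
    cases c with
    | bit b =>
      have hb := hp.bit b
      exact ih hb.1 ks hks hμ hz (by simp [hb.2]) hw
    | assign r =>
      have hb := hp.assign r
      cases z with
      -- Before the first evaluation nothing is recorded in `ks`, so all values may change.
      | false =>
        obtain rfl := hz rfl
        refine ih hb.1 [] (by simp) (fun c hc he hm => ?_) (fun _ => rfl) (by simp [hb.2]) hw
        simpa using hμ c hc he hm
      | true =>
        -- The frozen first components keep the recorded assignments paired with the same `f`.
        have hfst : ∀ x, (Function.update h u ((h u).1, r.2) x).1 = (h x).1 := by
          intro x
          by_cases hx : x = u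
          · subst hx
            simp
          · simp [Function.update_of_ne hx]
        refine ih hb.1 ks ?_ ?_ hz (by simp [hb.2]) hw
        · simpa [hfst] using hks
        · simpa [hfst] using hμ
    | eval =>
      by_cases hI : ∀ c ∈ I, c.isEq = true → c.Holds h
      · have hb := hp.eval hI
        -- A successful evaluation records the current second components, which justify the
        -- inequations marked in it.
        refine ih hb.1 ((fun x => (h x).2) :: ks) ?_ ?_ (by simp) ?_ hw
        · rintro k hk c hc he
          rcases List.mem_cons.1 hk with rfl | hk
          · exact hI c hc he
          · exact hks k hk c hc he
        · intro c hc he hm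
          simp only [updateMarks, he, Bool.not_false, Bool.true_and, Bool.or_eq_true,
            decide_eq_true_eq] at hm
          rcases hm with hm | hm
          · obtain ⟨k, hk, hck⟩ := hμ c hc he hm
            exact ⟨k, List.mem_cons_of_mem _ hk, hck⟩
          · exact ⟨_, List.mem_cons_self, hm⟩
        · intro hacc
          rw [hb.2, List.all_eq_true] at hacc
          refine ⟨by simp, fun c hc he => ?_⟩
          simpa [he] using hacc c hc
      · push Not at hI
        obtain ⟨c, hc, he, hch⟩ := hI
        rw [foldl_pass_none w (hp.eval_eq_none hc he hch)] at hw
        cases hw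

theorem exists_witnesses_of_verdict {w : List (Command (H × K))}
    (hw : (verifier H K).verdict (encodeInstance I, w) = true) :
    ∃ (f : List Bool → H) (ks : List (List Bool → K)), ks ≠ [] ∧ Witnesses I f ks :=
  (config_init I).exists_witnesses w [] (by simp) (by simp) (by simp) (by simp [verifier]) hw

/-! #### Instances with witnesses are accepted -/

/-- The variables of an instance. -/
def variableNames (I : List (Constraint addGroupLang)) : List (List Bool) :=
  I.flatMap fun c => (c.lhs.listEncode ++ c.rhs.listEncode).filterMap Sum.getLeft?

theorem realize_eq_of_forall_mem {A : Type*} [AddGroup A] {v v' : List Bool → A}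
    (t : addGroupLang.Term (List Bool)) (hv : ∀ n, Sum.inl n ∈ t.listEncode → v n = v' n) :
    t.realize v = t.realize v' := by
  induction t with
  | var n => exact hv n (by simp [FirstOrder.Language.Term.listEncode])
  | func f ts ih =>
    simp only [FirstOrder.Language.Term.realize]
    congr 1
    funext i
    refine ih i fun n hn => hv n ?_
    simp only [FirstOrder.Language.Term.listEncode, List.mem_cons, List.mem_flatMap]
    exact .inr ⟨i, List.mem_finRange i, hn⟩

theorem holds_iff_of_forall_mem {A : Type*} [AddGroup A] {v v' : List Bool → A}
    {c : Constraint addGroupLang} (hc : c ∈ I) (hv : ∀ n ∈ variableNames I, v n = v' n) :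
    c.Holds v ↔ c.Holds v' := by
  have h : ∀ n, Sum.inl n ∈ c.lhs.listEncode ++ c.rhs.listEncode → v n = v' n := fun n hn =>
    hv n (List.mem_flatMap.2 ⟨c, hc, List.mem_filterMap.2 ⟨_, hn, rfl⟩⟩)
  rw [Constraint.Holds, Constraint.Holds,
    realize_eq_of_forall_mem c.lhs fun n hn => h n (List.mem_append_left _ hn),
    realize_eq_of_forall_mem c.rhs fun n hn => h n (List.mem_append_right _ hn)]

/-- The part of a certificate that assigns values to variables. -/
def assignments {R : Type} (g : List Bool → R) (V : List (List Bool)) : List (Command R) :=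
  V.flatMap fun n => n.map .bit ++ [.assign (g n)]

theorem Config.bits (hp : Config z u h μ I p) (v : List Bool) :
    Config z (u ++ v) h μ I ((v.map .bit).foldl (verifier H K).pass p) := by
  induction v generalizing u p with
  | nil => simpa using hp
  | cons b v ih => simpa using ih (hp.bit b).1

/-- Once the values are frozen, `g` can be written only if its first components are already in
place. -/
theorem Config.assignments (hp : Config z [] h μ I p) (g : List Bool → H × K) (V : List (List Bool))
    (hg : z = true → ∀ n ∈ V, (h n).1 = (g n).1) :
    ∃ h' : List Bool → H × K, (∀ n, h' n = if n ∈ V then g n else h n) ∧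
      Config z [] h' μ I ((AddGroupCSP.assignments g V).foldl (verifier H K).pass p) := by
  induction V generalizing h p with
  | nil => exact ⟨h, by simp, hp⟩
  | cons n V ih =>
    have h₁ := ((hp.bits n).assign (g n)).1
    rw [List.nil_append] at h₁
    have h₂ : (if z then ((h n).1, (g n).2) else g n) = g n := by
      cases z with
      | false => rfl
      | true => simp [hg rfl n List.mem_cons_self]
    rw [h₂] at h₁
    have h₃ : ∀ m, Function.update h n (g n) m = if m = n then g n else h m := fun m =>
      Function.update_apply h n (g n) m
    obtain ⟨h', h₄, h₅⟩ := ih h₁ fun hz m hm => by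
      rw [h₃]
      split
      · simp_all
      · exact hg hz m (List.mem_cons_of_mem _ hm)
    refine ⟨h', fun m => ?_, ?_⟩
    · rw [h₄, h₃]
      by_cases hm : m = n
      · simp [hm]
      · simp [hm]
    · simpa [AddGroupCSP.assignments, List.foldl_append] using h₅

/-- The certificate for given witnesses. -/
def certificate {A B : Type} (I : List (Constraint addGroupLang)) (f : List Bool → A) (ks : List (List Bool → B)) :
    List (Command (A × B)) :=
  ks.flatMap fun k => assignments (fun x => (f x, k x)) (variableNames I) ++ [.eval]

/-- The first block sets the common first components and the later ones change only the second.
After the last evaluation every inequation is marked. -/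
theorem Config.certificate {f : List Bool → H} {ks : List (List Bool → K)} (hp : Config z [] h μ I p)
    (hz : z = true → ∀ n ∈ variableNames I, (h n).1 = f n) (hne : ks ≠ [])
    (hks : ∀ k ∈ ks, ∀ c ∈ I, c.isEq = true → c.Holds fun x => (f x, k x))
    (hμ : ∀ c ∈ I, c.isEq = false → μ c = true ∨ ∃ k ∈ ks, c.Holds fun x => (f x, k x)) :
    (verifier H K).accept
      ((AddGroupCSP.certificate I f ks).foldl (verifier H K).pass p).1 = true := by
  induction ks generalizing z h μ p with
  | nil => exact absurd rfl hne
  | cons k ks ih =>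
    obtain ⟨h', h₁, h₂⟩ := hp.assignments (fun x => (f x, k x)) (variableNames I) hz
    have h₃ : ∀ c ∈ I, (c.Holds h' ↔ c.Holds fun x => (f x, k x)) := fun c hc =>
      holds_iff_of_forall_mem hc fun n hn => by simp [h₁, hn]
    have h₄ := h₂.eval fun c hc he => (h₃ c hc).2 (hks k List.mem_cons_self c hc he)
    have h₅ : ∀ c ∈ I, c.isEq = false →
        updateMarks h' μ c = true ∨ ∃ k ∈ ks, c.Holds fun x => (f x, k x) := by
      intro c hc he
      simp only [updateMarks, he, Bool.not_false, Bool.true_and, Bool.or_eq_true, decide_eq_true_eq,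
        h₃ c hc]
      have := hμ c hc he
      simp only [List.exists_mem_cons_iff] at this
      tauto
    simp only [AddGroupCSP.certificate, List.flatMap_cons, List.foldl_append, List.foldl_cons,
      List.foldl_nil]
    by_cases hks0 : ks = []
    · subst hks0
      rw [List.flatMap_nil, List.foldl_nil, h₄.2, List.all_eq_true]
      intro c hc
      cases he : c.isEq
      · simpa using h₅ c hc he
      · rfl
    · exact ih h₄.1 (fun _ n hn => by simp [h₁, hn]) hks0
        (fun k hk => hks k (List.mem_cons_of_mem _ hk)) h₅

theorem verdict_certificate {f : List Bool → H} {ks : List (List Bool → K)} (hne : ks ≠ [])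
    (hw : Witnesses I f ks) :
    (verifier H K).verdict (encodeInstance I, certificate I f ks) = true :=
  (config_init I).certificate (by simp) hne hw.1 fun c hc he => .inr (hw.2 c hc he)

theorem length_le_length_encodeInstance (I : List (Constraint addGroupLang)) :
    I.length ≤ (encodeInstance I).length := by
  induction I with
  | nil => simp
  | cons c I ih =>
    have : encodeInstance (c :: I) = encodeConstraint c ++ encodeInstance I := rfl
    rw [this, List.length_append, List.length_cons, encodeConstraint]
    simp
    omega

/-- An occurrence of a variable takes as many letters in the certificate as in the instance;
`assign` matches the end marker. Repeated names do no harm. -/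
theorem length_assignments_le {R : Type} (g : List Bool → R) (I : List (Constraint addGroupLang)) :
    (assignments g (variableNames I)).length ≤ (encodeInstance I).length := by
  have htok : ∀ l : List (List Bool ⊕ (Σ n, addGroupLang.Functions n)),
      (assignments g (l.filterMap Sum.getLeft?)).length ≤ (l.flatMap encodeToken).length := by
    intro l
    induction l with
    | nil => simp [assignments]
    | cons s l ih =>
      rcases s with n | f
      · simpa [assignments, encodeToken] using ih
      · simp only [List.flatMap_cons, List.length_append]
        exact ih.trans (Nat.le_add_left _ _)
  induction I with
  | nil => simp [assignments, variableNames]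
  | cons c I ih =>
    have h₁ : encodeInstance (c :: I) = encodeConstraint c ++ encodeInstance I := rfl
    have h₂ : assignments g (variableNames (c :: I)) =
        assignments g (c.lhs.listEncode.filterMap Sum.getLeft?) ++
          assignments g (c.rhs.listEncode.filterMap Sum.getLeft?) ++ assignments g (variableNames I) := by
      simp [assignments, variableNames]
    have h₃ := htok c.lhs.listEncode
    have h₄ := htok c.rhs.listEncode
    rw [h₁, h₂]
    simp only [encodeConstraint, encodeTerm, List.length_append, List.length_cons]
    omega

theorem length_certificate_le {A B : Type} {f : List Bool → A} {ks : List (List Bool → B)}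
    (hks : ks.length ≤ I.length + 1) :
    (certificate I f ks).length ≤
      ((encodeInstance I).length + 1) * ((encodeInstance I).length + 1) := by
  have h₁ : ∀ ks : List (List Bool → B),
      (certificate I f ks).length ≤ ks.length * ((encodeInstance I).length + 1) := by
    intro ks
    induction ks with
    | nil => simp [certificate]
    | cons k ks ih =>
      have : certificate I f (k :: ks) =
        (assignments (fun x => (f x, k x)) (variableNames I) ++ [.eval]) ++ certificate I f ks := rfl
      rw [this, List.length_append, List.length_append, List.length_cons (as := ks), add_mul, one_mul]
      have := length_assignments_le (fun x => (f x, k x)) I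
      simp only [List.length_singleton]
      omega
  refine (h₁ ks).trans (Nat.mul_le_mul_right _ ?_)
  have := length_le_length_encodeInstance I
  omega

/-! #### Finiteness -/

instance : Finite (CSPSymbol addGroupLang) := by
  have : Finite (Σ n, addGroupLang.Functions n) := by
    refine Finite.of_injective (β := Fin 3) (fun
      | ⟨_, AddGroupFunc.zero⟩ => 0
      | ⟨_, AddGroupFunc.neg⟩ => 1
      | ⟨_, AddGroupFunc.add⟩ => 2) ?_
    rintro ⟨_, _ | _ | _⟩ ⟨_, _ | _ | _⟩ h <;> first | rfl | simp at h
  refine Finite.of_injective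
    (β := (Σ n, addGroupLang.Functions n) ⊕ Bool ⊕ Bool ⊕ Unit ⊕ Unit) (fun
      | .func f => .inl f
      | .bit b => .inr (.inl b)
      | .rel b => .inr (.inr (.inl b))
      | .varEnd => .inr (.inr (.inr (.inl ())))
      | .sep => .inr (.inr (.inr (.inr ())))) ?_
  rintro (_ | _ | _ | _ | _) (_ | _ | _ | _ | _) h <;> simp_all

instance {R : Type} [Finite R] : Finite (Command R) := by
  refine Finite.of_injective (β := Bool ⊕ R ⊕ Unit) (fun
      | .bit b => .inl b
      | .assign r => .inr (.inl r)
      | .eval => .inr (.inr ())) ?_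
  rintro (_ | _ | _) (_ | _ | _) h <;> simp_all

instance {R : Type} [Finite R] : Finite (EvalState R) := by
  refine Finite.of_injective (β := R × Bool × Bool × Bool × Bool × Bool)
    (fun e => (e.sum, e.right, e.fresh, e.name, e.isEq, e.all)) ?_
  rintro ⟨⟩ ⟨⟩ h
  simp_all

instance {R : Type} [Finite R] : Finite (Mode R) := by
  refine Finite.of_injective (β := (Bool × Bool × Bool) ⊕ (R × Bool) ⊕ EvalState R) (fun
      | .bit b f m => .inl (b, f, m)
      | .assign r m => .inr (.inl (r, m))
      | .eval e => .inr (.inr e)) ?_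
  rintro (_ | _ | _) (_ | _ | _) h <;> simp_all

end AddGroupCSP

theorem mainTheorem8 (G : Type*) [AddCommGroup G] (hG : IsOmegaCategorical addGroupLang G) :
    InNP (CSPNeq addGroupLang G) := by
  classical
  obtain ⟨m, hm, hmG⟩ := hG.exists_exponent
  obtain ⟨H, K, _, _, _, _, hsep, hH, hK⟩ := AddCommGroup.exists_finite_separating hm hmG
  have : Fintype (CSPSymbol addGroupLang) := Fintype.ofFinite _
  have : Fintype (AddGroupCSP.Command (H × K)) := Fintype.ofFinite _
  have : Fintype (AddGroupCSP.TapeSymbol (H × K)) := Fintype.ofFinite _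
  have : Fintype (Option (Bool × AddGroupCSP.Mode (H × K))) := Fintype.ofFinite _
  have : Inhabited (AddGroupCSP.TapeSymbol (H × K)) := ⟨(.sep, false, 0)⟩
  refine ⟨AddGroupCSP.Command (H × K), inferInstance, (AddGroupCSP.verifier H K).verdict,
    (Polynomial.X + 1) * (Polynomial.X + 1), PassVerifier.computableInPolyTime _, fun x => ⟨?_, ?_⟩⟩
  · rintro ⟨I, rfl, v, hv⟩
    obtain ⟨f, ks, hne, hlen, hw⟩ := exists_witnesses hsep hv
    refine ⟨AddGroupCSP.certificate I f ks, ?_, AddGroupCSP.verdict_certificate hne hw⟩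
    simpa using AddGroupCSP.length_certificate_le hlen
  -- Soundness holds for certificates of any length.
  · rintro ⟨w, -, hw⟩
    obtain ⟨I, rfl⟩ := AddGroupCSP.exists_encodeInstance_eq_of_verdict hw
    obtain ⟨f, ks, hne, hks⟩ := AddGroupCSP.exists_witnesses_of_verdict hw
    exact ⟨I, rfl, hks.satisfiable hH hK hne⟩
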